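/- Let $F$ be a non-Archimedean, non-discrete locally compact field whose residue field has characteristic different from $2$, with valuation ring $\mathfrak o$ and maximal ideal $\mathfrak p$. Let $G=\mathrm{PGL}(2,F)$, and let $X$ be its Bruhat–Tits tree: the vertices are the homothety classes $[L]$ of full $\mathfrak o$-lattices $L\subset F^2$, and two vertices are adjacent if and only if they are of the form $[\mathfrak o e_1\oplus\mathfrak o e_2]$ and $[\mathfrak o e_1\oplus\mathfrak p e_2]$ for some basis $(e_1,e_2)$ of $F^2$. For $k\ge 0$, an oriented $k$-path in $X$ is an injective sequence $(s_0,\dots,s_k)$ of vertices with $s_i$ and $s_{i+1}$ adjacent for $0\le i<k$. For $n\ge 0$, let $\tilde X_n$ be the directed graph whose vertices are the oriented $n$-paths and whose edges are the oriented $(n+1)$-paths; the edge $a=(s_0,\dots,s_{n+1})$ has tail $a^-=(s_0,\dots,s_n)$ and head $a^+=(s_1,\dots,s_{n+1})$. (So $\tilde X_0$ has the vertices of $X$ as vertices and the oriented edges of $X$ as edges.) The group $G$ acts on $\tilde X_n$ by automorphisms of directed graphs. For a locally finite directed graph $\Gamma$ with vertex set $V$ and edge set $E$, let $H^1_c(\Gamma)$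 be the cokernel of the map $d$ from the finitely supported functions $V\to\mathbb C$ to the finitely supported functions $E\to\mathbb C$ given by $(df)(a)=f(a^+)-f(a^-)$; if $\Gamma$ is finite, write $H^1(\Gamma)=H^1_c(\Gamma)$. A group of automorphisms of $\Gamma$ acts linearly on these spaces. Let $m\ge 1$ and let $s_0$ be any vertex of $X$, with stabilizer $\mathcal K_{s_0}$ in $G$. Let $\tilde X_{s_0}$ be the finite subgraph of $\tilde X_{2m-1}$ formed of the edges $(s_{-m},\dots,s_0,\dots,s_m)$ whose middle vertex is $s_0$, together with their end points; $\mathcal K_{s_0}$ acts on it. Then there is an isomorphism of $G$-modules $$H^1_c(\tilde X_{2m-1})\;\cong\; H^1_c(\tilde X_{2m-2})\;\oplus\;\text{c-Ind}_{\mathcal K_{s_0}}^{G} H^1(\tilde X_{s_0}).$$ Here, for a representation $(\sigma,W)$ of $\mathcal K_{s_0}$, $\text{c-Ind}_{\mathcal K_{s_0}}^G\sigma$ is the space of functions $f:G\to W$ such that $f(kg)=\sigma(k)f(g)$ for $k\in\mathcal K_{s_0}$ and $g\in G$, that are invariant under right translation by some open subgroup of $G$ and supported in $\mathcal K_{s_0}C$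 for some compact $C\subset G$; $G$ acts on it by right translation. -/

import Mathlib

open scoped MatrixGroups ValuativeRel Pointwise

universe u

noncomputable section

/-! ### Directed graphs, cohomology with compact support -/

/-- A directed graph with vertex set `V` and edge set `E` (several edges may join two vertices). -/
structure DirectedGraph (V E : Type*) where
  /-- the tail `a⁻` of the edge `a` -/
  tail : E → V
  /-- the head `a⁺` of the edge `a` -/
  head : E → V

/-- The space of complex functions with finite support on a set. -/
def finSupp (S : Type*) : Submodule ℂ (S → ℂ) where
  carrier := {f | (Function.support f).Finite}
  zero_mem' := by simp
  add_mem' := fun {f g} hf hg => (hf.union hg).subset (Function.support_add f g)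
  smul_mem' := fun c f hf => Set.Finite.subset hf (Function.support_const_smul_subset c f)

/-- The action of a group on the complex functions on a set on which it acts:
`(h f)(x) = f (h⁻¹ x)`. -/
def funRep (H : Type*) [Group H] (S : Type*) [MulAction H S] : Representation ℂ H (S → ℂ) where
  toFun h :=
    { toFun := fun f x => f (h⁻¹ • x)
      map_add' := fun _ _ => rfl
      map_smul' := fun _ _ => rfl }
  map_one' := by ext; simp
  map_mul' g h := by
    refine LinearMap.ext fun f => funext fun x => ?_
    simp [mul_smul]

theorem finSupp_le_comap (H : Type*) [Group H] (S : Type*) [MulAction H S] (h : H) :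
    finSupp S ≤ (finSupp S).comap (funRep H S h) := by
  intro f hf
  have hf' : (Function.support f).Finite := hf
  refine (hf'.image (fun x => h • x)).subset fun x hx => ⟨h⁻¹ • x, hx, ?_⟩
  simp

namespace DirectedGraph

variable {V E : Type*} (Γ : DirectedGraph V E)

/-- The coboundary map: `(d f)(a) = f (a⁺) - f (a⁻)`. -/
def coboundary : (V → ℂ) →ₗ[ℂ] (E → ℂ) where
  toFun f a := f (Γ.head a) - f (Γ.tail a)
  map_add' f g := by ext a; simp only [Pi.add_apply]; ring
  map_smul' c f := by ext a; simp only [Pi.smul_apply, smul_eq_mul, RingHom.id_apply]; ring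

/-- The group `H`, acting on vertices and on edges, acts by automorphisms of the directed graph. -/
def IsInvariant (H : Type*) [Group H] [MulAction H V] [MulAction H E] : Prop :=
  ∀ (h : H) (a : E), Γ.tail (h • a) = h • Γ.tail a ∧ Γ.head (h • a) = h • Γ.head a

/-- The finitely supported `1`-cochains that are coboundaries of finitely supported `0`-cochains. -/
def coboundaries : Submodule ℂ (finSupp E) :=
  ((finSupp V).map Γ.coboundary).submoduleOf (finSupp E)

/-- First cohomology space with compact support (and complex coefficients) of a locally finite
directed graph.  An edge is oriented by its direction, so a `1`-cochain, which takes opposite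
values on the two orientations of an edge, is a function on the set of edges.  If the graph is
finite, then this is its first cohomology space `H¹`. -/
abbrev H1c : Type _ := finSupp E ⧸ Γ.coboundaries

theorem coboundaries_le_comap {H : Type*} [Group H] [MulAction H V] [MulAction H E]
    (hΓ : Γ.IsInvariant H) (h : H) :
    Γ.coboundaries ≤ Γ.coboundaries.comap
      ((funRep H E).subrepresentation (finSupp E) (finSupp_le_comap H E) h) := by
  rintro ⟨w, hw⟩ ⟨f, hf, hfw⟩
  refine ⟨funRep H V h f, finSupp_le_comap H V h hf, ?_⟩
  have hfw' : Γ.coboundary f = w := hfw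
  subst hfw'
  funext a
  change f (h⁻¹ • Γ.head a) - f (h⁻¹ • Γ.tail a)
    = f (Γ.head (h⁻¹ • a)) - f (Γ.tail (h⁻¹ • a))
  rw [(hΓ h⁻¹ a).1, (hΓ h⁻¹ a).2]

/-- The representation of a group of automorphisms of `Γ` on its first cohomology space with
compact support. -/
def H1cRep {H : Type*} [Group H] [MulAction H V] [MulAction H E] (hΓ : Γ.IsInvariant H) :
    Representation ℂ H Γ.H1c :=
  ((funRep H E).subrepresentation (finSupp E) (finSupp_le_comap H E)).quotient Γ.coboundaries
    (Γ.coboundaries_le_comap hΓ)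

end DirectedGraph

/-! ### Compact induction -/

section CompactInduction

variable {G : Type*} [Group G] [TopologicalSpace G] [IsTopologicalGroup G] (K : Subgroup G)
  {W : Type*} [AddCommGroup W] [Module ℂ W] (σ : Representation ℂ K W)

/-- The space of the representation of `G` compactly induced from the representation `σ` of `K`:
the functions `f : G → W` with `f (k g) = σ(k) f (g)`, invariant under right translation by some
open subgroup of `G`, and supported in `K C` for some compact subset `C` of `G`. -/
def compactIndSpace : Submodule ℂ (G → W) where
  carrier := {f | (∀ (k : K) (g : G), f (k * g) = σ k (f g)) ∧
    (∃ U : Subgroup G, IsOpen (U : Set G) ∧ ∀ x ∈ U, ∀ g : G, f (g * x) = f g) ∧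
    (∃ C : Set G, IsCompact C ∧ Function.support f ⊆ (K : Set G) * C)}
  zero_mem' := ⟨by simp, ⟨⊤, isOpen_univ, by simp⟩, ∅, isCompact_empty, by simp⟩
  add_mem' := by
    rintro f f' ⟨h1, ⟨U, hU, h2⟩, C, hC, h3⟩ ⟨h1', ⟨U', hU', h2'⟩, C', hC', h3'⟩
    refine ⟨fun k g => by simp [h1, h1'], ⟨U ⊓ U', hU.inter hU', fun x hx g => ?_⟩,
      C ∪ C', hC.union hC', ?_⟩
    · simp [h2 x hx.1, h2' x hx.2]
    · rw [Set.mul_union]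
      exact (Function.support_add f f').trans (Set.union_subset_union h3 h3')
  smul_mem' := by
    rintro c f ⟨h1, ⟨U, hU, h2⟩, C, hC, h3⟩
    refine ⟨fun k g => by simp [h1], ⟨U, hU, fun x hx g => by simp [h2 x hx]⟩, C, hC, ?_⟩
    exact (Function.support_const_smul_subset c f).trans h3

/-- Right translation on functions: `(g f)(x) = f (x g)`. -/
def rightTranslation (G : Type*) [Group G] (W : Type*) [AddCommGroup W] [Module ℂ W] :
    Representation ℂ G (G → W) where
  toFun g :=
    { toFun := fun f x => f (x * g)
      map_add' := fun _ _ => rfl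
      map_smul' := fun _ _ => rfl }
  map_one' := by
    refine LinearMap.ext fun f => funext fun x => ?_
    simp
  map_mul' g h := by
    refine LinearMap.ext fun f => funext fun x => ?_
    simp [mul_assoc]

theorem compactIndSpace_le_comap (g : G) :
    compactIndSpace K σ ≤ (compactIndSpace K σ).comap (rightTranslation G W g) := by
  rintro f ⟨h1, ⟨U, hU, h2⟩, C, hC, h3⟩
  refine ⟨fun k x => ?_, ⟨U.comap (MulAut.conj g⁻¹).toMonoidHom, ?_, fun x hx y => ?_⟩,
    C * {g⁻¹}, hC.mul isCompact_singleton, ?_⟩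
  · change f (k * x * g) = σ k (f (x * g))
    rw [mul_assoc, h1]
  · refine hU.preimage ?_
    change Continuous fun x => g⁻¹ * x * g⁻¹⁻¹
    fun_prop
  · change f (y * x * g) = f (y * g)
    have := h2 _ hx (y * g)
    rw [← this]
    congr 1
    simp [mul_assoc]
  · intro x hx
    have hx' : f (x * g) ≠ 0 := hx
    rw [← mul_assoc]
    exact ⟨x * g, h3 hx', g⁻¹, rfl, by simp⟩

/-- The compactly induced representation `c-Ind_K^G σ`, on which `G` acts by right translation. -/
def compactInd : Representation ℂ G (compactIndSpace K σ) :=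
  (rightTranslation G W).subrepresentation (compactIndSpace K σ) (compactIndSpace_le_comap K σ)

end CompactInduction

/-! ### The group `PGL(2, F)` and its tree -/

section Topology

variable (F : Type u) [Field F] [TopologicalSpace F]

/-- The quotient topology on `PGL(2, F) = GL(2, F) / center`. -/
instance : TopologicalSpace PGL(2, F) :=
  inferInstanceAs (TopologicalSpace (GL (Fin 2) F ⧸ Subgroup.center (GL (Fin 2) F)))

instance [IsTopologicalRing F] : IsTopologicalGroup PGL(2, F) :=
  inferInstanceAs (IsTopologicalGroup (GL (Fin 2) F ⧸ Subgroup.center (GL (Fin 2) F)))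

end Topology

namespace BruhatTits

variable (F : Type u) [Field F] [ValuativeRel F]

/-- The full `𝒪`-lattices in `F²`, where `𝒪` is the valuation ring of `F`. -/
abbrev Lattice : Type u := {L : Submodule 𝒪[F] (Fin 2 → F) // L.IsLattice F}

variable {F}

theorem isLattice_map (g : GL (Fin 2) F) {L : Submodule 𝒪[F] (Fin 2 → F)} (hL : L.IsLattice F) :
    (L.map ((Matrix.toLin' g.1).restrictScalars 𝒪[F])).IsLattice F where
  fg := hL.fg.map _
  span_eq_top := by
    have h1 : Submodule.span F ((L.map ((Matrix.toLin' g.1).restrictScalars 𝒪[F]) :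
        Submodule 𝒪[F] (Fin 2 → F)) : Set (Fin 2 → F))
        = (Submodule.span F (L : Set (Fin 2 → F))).map (Matrix.toLin' g.1) := by
      rw [Submodule.map_span]
      rfl
    rw [h1, hL.span_eq_top, Submodule.map_top, LinearMap.range_eq_top]
    intro v
    refine ⟨Matrix.toLin' (g⁻¹).1 v, ?_⟩
    rw [← LinearMap.comp_apply, ← Matrix.toLin'_mul, ← Units.val_mul, mul_inv_cancel]
    simp

/-- `GL(2, F)` acts on the lattices: `g` sends `L` to its image `g L`. -/
instance : MulAction (GL (Fin 2) F) (Lattice F) where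
  smul g L := ⟨L.1.map ((Matrix.toLin' g.1).restrictScalars 𝒪[F]), isLattice_map g L.2⟩
  one_smul L := by
    refine Subtype.ext ?_
    change L.1.map ((Matrix.toLin' (1 : GL (Fin 2) F).1).restrictScalars 𝒪[F]) = L.1
    ext v
    simp
  mul_smul g h L := by
    refine Subtype.ext ?_
    change L.1.map ((Matrix.toLin' (g * h).1).restrictScalars 𝒪[F])
      = (L.1.map ((Matrix.toLin' h.1).restrictScalars 𝒪[F])).map
        ((Matrix.toLin' g.1).restrictScalars 𝒪[F])
    rw [← Submodule.map_comp]
    congr 1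
    ext v
    simp

theorem smul_val (g : GL (Fin 2) F) (L : Lattice F) :
    (g • L).1 = L.1.map ((Matrix.toLin' g.1).restrictScalars 𝒪[F]) := rfl

/-- The image of a lattice under a homothety. -/
theorem scalar_smul_val (c : Fˣ) (L : Lattice F) :
    (Matrix.GeneralLinearGroup.scalar (Fin 2) c • L).1 = c • L.1 := by
  rw [smul_val]
  ext v
  rw [Submodule.mem_map]
  change _ ↔ ∃ w, w ∈ L.1 ∧ c • w = v
  refine exists_congr fun w => and_congr_right fun _ => ?_
  have : Matrix.toLin' (Matrix.GeneralLinearGroup.scalar (Fin 2) c).1 w = c • w := by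
    ext i
    simp [Units.smul_def, Matrix.mulVec, dotProduct, Matrix.scalar_apply, Matrix.diagonal_apply]
  rw [← this]
  rfl

variable (F) in
/-- Two lattices `L` and `M` are homothetic if `M = c L` for some `c ∈ Fˣ`. -/
def homothety : Setoid (Lattice F) where
  r L M := ∃ c : Fˣ, M.1 = c • L.1
  iseqv :=
    { refl := fun L => ⟨1, by simp⟩
      symm := by
        rintro L M ⟨c, h⟩
        exact ⟨c⁻¹, by rw [h, inv_smul_smul]⟩
      trans := by
        rintro L M N ⟨c, h⟩ ⟨c', h'⟩
        exact ⟨c' * c, by rw [h', h, mul_smul]⟩ }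

variable (F) in
/-- The vertices of the tree: the homothety classes `[L]` of lattices in `F²`. -/
abbrev Vertex : Type u := Quotient (homothety F)

/-- The homothety class of a lattice. -/
def Vertex.mk (L : Lattice F) : Vertex F := Quotient.mk (homothety F) L

theorem Vertex.mk_eq_mk {L M : Lattice F} :
    Vertex.mk L = Vertex.mk M ↔ ∃ c : Fˣ, M.1 = c • L.1 :=
  Quotient.eq (r := homothety F)

theorem smul_homothetic (g : GL (Fin 2) F) {L M : Lattice F} (h : homothety F L M) :
    homothety F (g • L) (g • M) := by
  obtain ⟨c, h⟩ := h
  refine ⟨c, ?_⟩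
  have hM : M = Matrix.GeneralLinearGroup.scalar (Fin 2) c • L :=
    Subtype.ext (by rw [scalar_smul_val, h])
  rw [hM, ← scalar_smul_val, ← mul_smul, ← mul_smul]
  congr 2
  exact ((Matrix.GeneralLinearGroup.scalar_commute c g)).symm

/-- `GL(2, F)` acts on the vertices: `g [L] = [g L]`. -/
instance : MulAction (GL (Fin 2) F) (Vertex F) where
  smul g := Quotient.map (g • ·) fun _ _ h => smul_homothetic g h
  one_smul := by
    rintro ⟨L⟩
    exact congrArg Vertex.mk (one_smul _ L)
  mul_smul g h := by
    rintro ⟨L⟩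
    exact congrArg Vertex.mk (mul_smul g h L)

theorem smul_mk (g : GL (Fin 2) F) (L : Lattice F) : g • Vertex.mk L = Vertex.mk (g • L) := rfl

theorem scalar_smul_vertex (c : Fˣ) (s : Vertex F) :
    Matrix.GeneralLinearGroup.scalar (Fin 2) c • s = s := by
  obtain ⟨L, rfl⟩ : ∃ L, Vertex.mk L = s := Quotient.exists_rep s
  rw [smul_mk, eq_comm, Vertex.mk_eq_mk]
  exact ⟨c, scalar_smul_val c L⟩

/-- The action of `PGL(2, F)` on the vertices, through which that of `GL(2, F)` factors. -/
instance : MulAction PGL(2, F) (Vertex F) :=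
  Matrix.ProjGenLinGroup.mulActionOfGL scalar_smul_vertex

theorem mk_smul_vertex (g : GL (Fin 2) F) (s : Vertex F) :
    Matrix.ProjGenLinGroup.mk g • s = g • s := rfl

/-- `L = 𝒪 e₁ ⊕ 𝒪 e₂` and `M = 𝒪 e₁ ⊕ 𝔭 e₂` for some basis `(e₁, e₂)` of `F²`; here `ϖ` is a
uniformizer, so that `𝔭 = ϖ 𝒪`. -/
def LatticeAdj (L M : Lattice F) : Prop :=
  ∃ (e : Module.Basis (Fin 2) F (Fin 2 → F)) (ϖ : 𝒪[F]), Irreducible ϖ ∧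
    L.1 = Submodule.span 𝒪[F] {e 0, e 1} ∧ M.1 = Submodule.span 𝒪[F] {e 0, ϖ • e 1}

theorem LatticeAdj.not_homothetic {L M : Lattice F} (h : LatticeAdj L M) :
    ¬ homothety F L M := by
  obtain ⟨e, ϖ, hϖ, hL, hM⟩ := h
  rintro ⟨c, hc⟩
  have hli := e.linearIndependent
  have h1 : c • e 1 ∈ M.1 := by
    rw [hc, hL]
    exact ⟨e 1, Submodule.subset_span (by simp), rfl⟩
  have h0 : e 0 ∈ c • L.1 := by
    rw [← hc, hM]
    exact Submodule.subset_span (by simp)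
  obtain ⟨w, hw, hw'⟩ : ∃ w, w ∈ L.1 ∧ c • w = e 0 := h0
  rw [hM, Submodule.mem_span_pair] at h1
  rw [hL] at hw
  obtain ⟨x, y, rfl⟩ := Submodule.mem_span_pair.1 hw
  obtain ⟨a, b, hab⟩ := h1
  have h2 := congrArg (fun v => e.repr v 1) hab
  have h3 := congrArg (fun v => e.repr v 0) hw'
  simp only [Units.smul_def, Subring.smul_def, map_add, map_smul,
    Module.Basis.repr_self] at h2 h3
  simp at h2 h3
  apply hϖ.not_isUnit
  refine IsUnit.of_mul_eq_one (b * x) (Subtype.ext ?_)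
  change (ϖ : F) * (b * x) = 1
  rw [← h3, ← h2]
  change (ϖ : F) * (b * x) = (b * ϖ) * x
  ring

theorem LatticeAdj.symm {L M : Lattice F} (h : LatticeAdj L M) :
    ∃ L' : Lattice F, homothety F L L' ∧ LatticeAdj M L' := by
  obtain ⟨e, ϖ, hϖ, hL, hM⟩ := h
  have hϖ0 : (ϖ : F) ≠ 0 := fun h0 => hϖ.ne_zero (Subtype.ext h0)
  let c : Fˣ := Units.mk0 (ϖ : F) hϖ0
  refine ⟨Matrix.GeneralLinearGroup.scalar (Fin 2) c • L, ⟨c, scalar_smul_val c L⟩,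
    (e.unitsSMul ![1, c]).reindex (Equiv.swap 0 1), ϖ, hϖ, ?_, ?_⟩
  · rw [hM, Set.pair_comm]
    simp [Module.Basis.unitsSMul_apply]
    rfl
  · rw [scalar_smul_val, hL]
    change Submodule.map _ _ = _
    rw [Submodule.map_span, Set.image_pair, Set.pair_comm]
    simp [Module.Basis.unitsSMul_apply]
    rfl

theorem LatticeAdj.smul (g : GL (Fin 2) F) {L M : Lattice F} (h : LatticeAdj L M) :
    LatticeAdj (g • L) (g • M) := by
  obtain ⟨e, ϖ, hϖ, hL, hM⟩ := h
  refine ⟨e.map (Matrix.GeneralLinearGroup.toLin g).toLinearEquiv, ϖ, hϖ, ?_, ?_⟩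
  · rw [smul_val, hL, Submodule.map_span, Set.image_pair]
    rfl
  · rw [smul_val, hM, Submodule.map_span, Set.image_pair, LinearMap.map_smul]
    rfl

variable (F) in
/-- The tree `X` of `PGL(2, F)`: the vertices `[L]` and `[M]` are adjacent if, up to homothety,
`L = 𝒪 e₁ ⊕ 𝒪 e₂` and `M = 𝒪 e₁ ⊕ 𝔭 e₂` for some basis `(e₁, e₂)` of `F²`. -/
def tree : SimpleGraph (Vertex F) where
  Adj s t := ∃ L M : Lattice F, Vertex.mk L = s ∧ Vertex.mk M = t ∧ LatticeAdj L M
  symm := ⟨by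
    rintro _ _ ⟨L, M, rfl, rfl, h⟩
    obtain ⟨L', hL', h'⟩ := h.symm
    exact ⟨M, L', rfl, (Quotient.sound hL').symm, h'⟩⟩
  loopless := ⟨by
    rintro _ ⟨L, M, rfl, hM, h⟩
    exact h.not_homothetic (Vertex.mk_eq_mk.1 hM.symm)⟩

theorem tree_adj_smul (g : PGL(2, F)) {s t : Vertex F} (h : (tree F).Adj s t) :
    (tree F).Adj (g • s) (g • t) := by
  induction g using Matrix.ProjGenLinGroup.induction_on with | mk g =>
  obtain ⟨L, M, rfl, rfl, h⟩ := h
  exact ⟨g • L, g • M, rfl, rfl, h.smul g⟩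

/-! ### The directed graphs `X̃ₙ` -/

variable (F) in
/-- The oriented `k`-paths of the tree: the injective sequences `(s₀, …, s_k)` of vertices such
that `s_i` and `s_{i+1}` are adjacent for `0 ≤ i < k`. -/
@[ext]
structure OrientedPath (k : ℕ) : Type u where
  /-- the `i`-th vertex of the path -/
  vertex : Fin (k + 1) → Vertex F
  injective : Function.Injective vertex
  adj : ∀ i : Fin k, (tree F).Adj (vertex i.castSucc) (vertex i.succ)

namespace OrientedPath

/-- `(s₀, …, s_{k+1}) ↦ (s₀, …, s_k)`. -/
def init {k : ℕ} (a : OrientedPath F (k + 1)) : OrientedPath F k where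
  vertex i := a.vertex i.castSucc
  injective := a.injective.comp (Fin.castSucc_injective _)
  adj i := a.adj i.castSucc

/-- `(s₀, …, s_{k+1}) ↦ (s₁, …, s_{k+1})`. -/
def tail {k : ℕ} (a : OrientedPath F (k + 1)) : OrientedPath F k where
  vertex i := a.vertex i.succ
  injective := a.injective.comp (Fin.succ_injective _)
  adj i := a.adj i.succ

instance (k : ℕ) : MulAction PGL(2, F) (OrientedPath F k) where
  smul g a := ⟨fun i => g • a.vertex i, (MulAction.injective g).comp a.injective,
    fun i => tree_adj_smul g (a.adj i)⟩
  one_smul a := OrientedPath.ext (funext fun i => one_smul _ (a.vertex i))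
  mul_smul g h a := OrientedPath.ext (funext fun i => mul_smul g h (a.vertex i))

theorem smul_vertex {k : ℕ} (g : PGL(2, F)) (a : OrientedPath F k) (i : Fin (k + 1)) :
    (g • a).vertex i = g • a.vertex i := rfl

end OrientedPath

variable (F) in
/-- The directed graph `X̃ₙ`: its vertices are the oriented `n`-paths of the tree, its edges are the
oriented `(n+1)`-paths; the edge `(s₀, …, s_{n+1})` has tail `(s₀, …, s_n)` and head
`(s₁, …, s_{n+1})`.  In particular the vertices of `X̃₀` are those of the tree, and its edges are
the oriented edges of the tree. -/
def tildeX (n : ℕ) : DirectedGraph (OrientedPath F n) (OrientedPath F (n + 1)) where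
  tail := OrientedPath.init
  head := OrientedPath.tail

theorem tildeX_isInvariant (n : ℕ) : (tildeX F n).IsInvariant PGL(2, F) :=
  fun _ _ => ⟨rfl, rfl⟩

/-! ### The fibre of `X̃_{2m-1}` above a vertex -/

/-- The edge `(s_{-m}, …, s_0, …, s_m)` of `X̃_{2m-1}` (an oriented `2m`-path) lies above its
middle vertex `s_0`; here `m ≥ 1`. -/
def LiesAbove (m : ℕ) (s : Vertex F) (a : OrientedPath F (2 * m - 1 + 1)) : Prop :=
  a.vertex ⟨m, by omega⟩ = s

/-- The edges of the fibre: the edges of `X̃_{2m-1}` that lie above `s`. -/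
abbrev FibreEdge (m : ℕ) (s : Vertex F) : Type u :=
  {a : OrientedPath F (2 * m - 1 + 1) // LiesAbove m s a}

/-- The vertices of the fibre: the end points of the edges of `X̃_{2m-1}` that lie above `s`. -/
abbrev FibreVertex (m : ℕ) (s : Vertex F) : Type u :=
  {v : OrientedPath F (2 * m - 1) // ∃ a : OrientedPath F (2 * m - 1 + 1), LiesAbove m s a ∧
    (v = (tildeX F (2 * m - 1)).tail a ∨ v = (tildeX F (2 * m - 1)).head a)}

/-- The (finite) subgraph `X̃_s` of `X̃_{2m-1}` formed of the edges lying above the vertex `s` of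
the tree. -/
def fibre (m : ℕ) (s : Vertex F) : DirectedGraph (FibreVertex m s) (FibreEdge m s) where
  tail a := ⟨(tildeX F (2 * m - 1)).tail a.1, a.1, a.2, Or.inl rfl⟩
  head a := ⟨(tildeX F (2 * m - 1)).head a.1, a.1, a.2, Or.inr rfl⟩

theorem LiesAbove.smul {m : ℕ} {s : Vertex F} {a : OrientedPath F (2 * m - 1 + 1)}
    (h : LiesAbove m s a) (g : MulAction.stabilizer PGL(2, F) s) : LiesAbove m s (g.1 • a) := by
  unfold LiesAbove at h ⊢
  rw [OrientedPath.smul_vertex, h]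
  exact g.2

instance (m : ℕ) (s : Vertex F) :
    MulAction (MulAction.stabilizer PGL(2, F) s) (FibreEdge m s) where
  smul g a := ⟨g.1 • a.1, a.2.smul g⟩
  one_smul a := Subtype.ext (one_smul _ a.1)
  mul_smul g h a := Subtype.ext (mul_smul g.1 h.1 a.1)

instance (m : ℕ) (s : Vertex F) :
    MulAction (MulAction.stabilizer PGL(2, F) s) (FibreVertex m s) where
  smul g v := ⟨g.1 • v.1, by
    obtain ⟨a, ha, h | h⟩ := v.2
    · exact ⟨g.1 • a, ha.smul g, Or.inl (by rw [h]; rfl)⟩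
    · exact ⟨g.1 • a, ha.smul g, Or.inr (by rw [h]; rfl)⟩⟩
  one_smul v := Subtype.ext (one_smul _ v.1)
  mul_smul g h v := Subtype.ext (mul_smul g.1 h.1 v.1)

theorem fibre_isInvariant (m : ℕ) (s : Vertex F) :
    (fibre m s).IsInvariant (MulAction.stabilizer PGL(2, F) s) :=
  fun _ _ => ⟨rfl, rfl⟩

end BruhatTits

end

/-! Write `a⁻ = a.init` and `a⁺ = a.tail` for the two end points of an edge of `X̃_n`. Pulling
cochains back along `a ↦ a⁻` gives a map `H¹_c(X̃_{2m-2}) → H¹_c(X̃_{2m-1})` (`initMap`);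
restricting all translates of a class to the fibre above `s₀` gives a map `H¹_c(X̃_{2m-1}) → c-Ind`
(`fibreTranslates`). Together they form a short exact sequence of `G`-modules that splits.

Exactness in the middle: every edge of `X̃_{2m-1}` lies in exactly one fibre, and the heads and the
tails of the edges of one fibre are disjoint. So `w` is a coboundary on every fibre exactly when
`w(a) = f(a⁺) - h(a⁻)` with independent, finitely supported `f` and `h`
(`fibreTranslates_mk_eq_zero_iff`). Subtracting `df` leaves `(f - h)(a⁻)`, a pull-back.

Injectivity on the left: if `w(a⁻) = f(a⁺) - f(a⁻)`, then `f(a⁺)` is a function of `a⁻`, which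
forces `f(v) = φ(v⁻)` and `(f + w)(v) = φ(v⁺)`, hence `w = dφ` (`exists_eq_comp_init_tail`,
`initMap_injective`).

Splitting: the fibre is finite, so the orthogonal complement of its coboundaries is a stable space
of representatives; since `G` is transitive on vertices, these are transported to all fibres and
glued (`exists_fibreTranslates_section`).

From the tree one needs that it is locally finite, that stabilizers are open, that paths without
backtracking do not close up, and that each vertex has three neighbours. -/

noncomputable section

/-! ### Lattices, transitivity and local finiteness -/

namespace BruhatTits

variable {F : Type u} [Field F] [ValuativeRel F]

theorem mem_span_basis_iff (e : Module.Basis (Fin 2) F (Fin 2 → F)) (x : Fin 2 → F) :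
    x ∈ Submodule.span 𝒪[F] {e 0, e 1} ↔ e.repr x 0 ∈ 𝒪[F] ∧ e.repr x 1 ∈ 𝒪[F] := by
  rw [Submodule.mem_span_pair]
  constructor
  · rintro ⟨a, b, rfl⟩
    simp [Subring.smul_def]
  · rintro ⟨h0, h1⟩
    refine ⟨⟨_, h0⟩, ⟨_, h1⟩, ?_⟩
    conv_rhs => rw [← e.sum_repr x, Fin.sum_univ_two]
    rfl

theorem mem_span_basis_smul_iff (e : Module.Basis (Fin 2) F (Fin 2 → F)) (ϖ : 𝒪[F])
    (x : Fin 2 → F) :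
    x ∈ Submodule.span 𝒪[F] {e 0, ϖ • e 1} ↔
      e.repr x 0 ∈ 𝒪[F] ∧ ∃ b : 𝒪[F], e.repr x 1 = ϖ * b := by
  rw [Submodule.mem_span_pair]
  constructor
  · rintro ⟨a, b, rfl⟩
    refine ⟨by simp [Subring.smul_def], b, by simp [Subring.smul_def, mul_comm]⟩
  · rintro ⟨h0, b, h1⟩
    refine ⟨⟨_, h0⟩, b, ?_⟩
    conv_rhs => rw [← e.sum_repr x, Fin.sum_univ_two, h1]
    simp [Subring.smul_def, smul_smul, mul_comm]

theorem LatticeAdj.le {L M : Lattice F} (h : LatticeAdj L M) : M.1 ≤ L.1 := by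
  obtain ⟨e, ϖ, hϖ, hL, hM⟩ := h
  rw [hL, hM, Submodule.span_le]
  rintro x (rfl | rfl)
  · exact Submodule.subset_span (by simp)
  · exact Submodule.smul_mem _ _ (Submodule.subset_span (by simp))

theorem mk_smul_lattice (c : Fˣ) (L : Lattice F) :
    Vertex.mk (Matrix.GeneralLinearGroup.scalar (Fin 2) c • L) = Vertex.mk L :=
  (Vertex.mk_eq_mk.2 ⟨c, scalar_smul_val c L⟩).symm

theorem LatticeAdj.exists_of_adj {L : Lattice F} {t : Vertex F}
    (h : (tree F).Adj (Vertex.mk L) t) : ∃ M, Vertex.mk M = t ∧ LatticeAdj L M := by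
  obtain ⟨L', M, h1, rfl, h⟩ := h
  obtain ⟨c, hc⟩ := Vertex.mk_eq_mk.1 h1
  have hL : L = Matrix.GeneralLinearGroup.scalar (Fin 2) c • L' :=
    Subtype.ext (by rw [scalar_smul_val, hc])
  exact ⟨_, mk_smul_lattice c M, hL ▸ h.smul _⟩

variable [TopologicalSpace F] [IsNonarchimedeanLocalField F]

/-- `L / M` is a line over the residue field: an element of `N` outside `M` has a unit as its second
coordinate, so `e 1 ∈ N`. -/
theorem LatticeAdj.eq_or_eq {L M : Lattice F} (h : LatticeAdj L M)
    {N : Submodule 𝒪[F] (Fin 2 → F)} (hMN : M.1 ≤ N) (hNL : N ≤ L.1) : N = M.1 ∨ N = L.1 := by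
  obtain ⟨e, ϖ, hϖ, hL, hM⟩ := h
  refine or_iff_not_imp_left.2 fun hne => ?_
  obtain ⟨x, hxN, hxM⟩ : ∃ x ∈ N, x ∉ M.1 := by
    by_contra! hc
    exact hne (le_antisymm hc hMN)
  have hxL := hNL hxN
  rw [hL, mem_span_basis_iff] at hxL
  rw [hM, mem_span_basis_smul_iff] at hxM
  have hu : IsUnit (⟨_, hxL.2⟩ : 𝒪[F]) := by
    by_contra hu
    have : (⟨_, hxL.2⟩ : 𝒪[F]) ∈ IsLocalRing.maximalIdeal 𝒪[F] := hu
    rw [hϖ.maximalIdeal_eq, Ideal.mem_span_singleton] at this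
    obtain ⟨b, hb⟩ := this
    exact hxM ⟨hxL.1, b, congrArg Subtype.val hb⟩
  obtain ⟨u, hu⟩ := hu
  have he0 : e 0 ∈ N := hMN (hM ▸ Submodule.subset_span (by simp))
  refine le_antisymm hNL ?_
  rw [hL, Submodule.span_le]
  rintro y (rfl | rfl)
  · exact he0
  have key : e 1 = (↑u⁻¹ : 𝒪[F]) • (x - (⟨_, hxL.1⟩ : 𝒪[F]) • e 0) := by
    have : x - (⟨_, hxL.1⟩ : 𝒪[F]) • e 0 = (u : 𝒪[F]) • e 1 := by
      rw [sub_eq_iff_eq_add', hu]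
      conv_lhs => rw [← e.sum_repr x, Fin.sum_univ_two]
      rfl
    rw [this, smul_smul]
    simp
  have : (↑u⁻¹ : 𝒪[F]) • (x - (⟨_, hxL.1⟩ : 𝒪[F]) • e 0) ∈ N :=
    N.smul_mem _ (N.sub_mem hxN (N.smul_mem _ he0))
  rwa [← key] at this

theorem exists_basis_of_lattice (L : Lattice F) :
    ∃ e : Module.Basis (Fin 2) F (Fin 2 → F), L.1 = Submodule.span 𝒪[F] {e 0, e 1} := by
  have := L.2
  have : Module.Free 𝒪[F] L.1 := Submodule.IsLattice.free F L.1
  let b : Module.Basis (Fin 2) 𝒪[F] L.1 :=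
    Module.finBasisOfFinrankEq 𝒪[F] L.1 (by simpa using Submodule.IsLattice.finrank_of_pi F L.1)
  refine ⟨b.extendOfIsLattice F, ?_⟩
  simp only [Module.Basis.extendOfIsLattice_apply]
  have := congrArg (Submodule.map L.1.subtype) b.span_eq
  rw [Submodule.map_span, Submodule.map_top, Submodule.range_subtype] at this
  refine this.symm.trans ?_
  congr 1
  ext x
  simp [Fin.exists_fin_two, eq_comm]

theorem exists_smul_vertex_eq (s t : Vertex F) : ∃ g : PGL(2, F), g • s = t := by
  obtain ⟨L, rfl⟩ : ∃ L, Vertex.mk L = s := Quotient.exists_rep s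
  obtain ⟨M, rfl⟩ : ∃ L, Vertex.mk L = t := Quotient.exists_rep t
  obtain ⟨e, he⟩ := exists_basis_of_lattice L
  obtain ⟨f, hf⟩ := exists_basis_of_lattice M
  let φ : (Fin 2 → F) ≃ₗ[F] (Fin 2 → F) := e.equiv f (Equiv.refl _)
  let g : GL (Fin 2) F := Matrix.GeneralLinearGroup.toLin.symm
    (LinearMap.GeneralLinearGroup.ofLinearEquiv φ)
  have hg : Matrix.toLin' g.1 = φ.toLinearMap := by
    have : Matrix.GeneralLinearGroup.toLin g = LinearMap.GeneralLinearGroup.ofLinearEquiv φ := by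
      simp [g]
    exact congrArg Units.val this
  refine ⟨Matrix.ProjGenLinGroup.mk g, ?_⟩
  rw [mk_smul_vertex, smul_mk]
  congr 1
  refine Subtype.ext ?_
  rw [smul_val, he, hf, Submodule.map_span, Set.image_pair, hg]
  simp [φ]

theorem LatticeAdj.finite (L : Lattice F) : {M | LatticeAdj L M}.Finite := by
  obtain ⟨e, he⟩ := exists_basis_of_lattice L
  obtain ⟨ϖ, hϖ⟩ := IsDiscreteValuationRing.exists_irreducible 𝒪[F]
  -- A neighbour contains `ϖ L`, so it is determined by its image in `L / ϖ L`, recorded here in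
  -- coordinates. That quotient is a finite set.
  let S : Lattice F → Set (𝓀[F] × 𝓀[F]) := fun M =>
    {p | ∃ a b : 𝒪[F], IsLocalRing.residue _ a = p.1 ∧ IsLocalRing.residue _ b = p.2 ∧
      a • e 0 + b • e 1 ∈ M.1}
  have hle : ∀ {M}, LatticeAdj L M → ∀ x ∈ L.1, ϖ • x ∈ M.1 := by
    rintro M ⟨e', ϖ', hϖ', hL, hM⟩ x hx
    obtain ⟨u, hu⟩ := IsDiscreteValuationRing.associated_of_irreducible 𝒪[F] hϖ' hϖ
    rw [hL, Submodule.mem_span_pair] at hx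
    obtain ⟨a, b, rfl⟩ := hx
    rw [hM, Submodule.mem_span_pair]
    refine ⟨ϖ * a, u * b, ?_⟩
    rw [← hu]
    module
  refine Set.Finite.of_finite_image (f := S) (Set.toFinite _) ?_
  have key : ∀ {M N}, LatticeAdj L M → LatticeAdj L N → S M = S N → M.1 ≤ N.1 := by
    intro M N hM hN h x hx
    have hxL := hM.le hx
    rw [he, Submodule.mem_span_pair] at hxL
    obtain ⟨a, b, rfl⟩ := hxL
    have : (IsLocalRing.residue _ a, IsLocalRing.residue _ b) ∈ S N := h ▸ ⟨a, b, rfl, rfl, hx⟩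
    obtain ⟨a', b', ha, hb, h'⟩ := this
    have hd : ∀ {c d : 𝒪[F]}, IsLocalRing.residue _ c = IsLocalRing.residue _ d →
        ∃ r, d = c + ϖ * r := by
      intro c d hcd
      rw [← sub_eq_zero, ← map_sub, IsLocalRing.residue_eq_zero_iff, hϖ.maximalIdeal_eq,
        Ideal.mem_span_singleton] at hcd
      obtain ⟨r, hr⟩ := hcd
      exact ⟨-r, by linear_combination -hr⟩
    obtain ⟨r, rfl⟩ := hd ha
    obtain ⟨t, rfl⟩ := hd hb
    have h2 : ϖ • (r • e 0 + t • e 1) ∈ N.1 :=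
      hle hN _ (he ▸ Submodule.mem_span_pair.2 ⟨r, t, rfl⟩)
    convert N.1.add_mem h' h2 using 1
    module
  intro M hM N hN h
  exact Subtype.ext (le_antisymm (key hM hN h) (key hN hM h.symm))

theorem finite_neighbors (s : Vertex F) : {t | (tree F).Adj s t}.Finite := by
  obtain ⟨L, rfl⟩ : ∃ L, Vertex.mk L = s := Quotient.exists_rep s
  refine ((LatticeAdj.finite L).image Vertex.mk).subset ?_
  intro t ht
  obtain ⟨M, rfl, hM⟩ := LatticeAdj.exists_of_adj ht
  exact ⟨M, hM, rfl⟩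

end BruhatTits

/-! ### Open stabilizers, paths without backtracking, number of neighbours -/

namespace BruhatTits

variable {F : Type u} [Field F] [ValuativeRel F]

theorem smul_lattice_le (e : Module.Basis (Fin 2) F (Fin 2 → F)) {L : Lattice F}
    (he : L.1 = Submodule.span 𝒪[F] {e 0, e 1}) (g : GL (Fin 2) F)
    (hg : ∀ i j, e.repr (Matrix.toLin' g.1 (e i)) j ∈ 𝒪[F]) : (g • L).1 ≤ L.1 := by
  have h : ∀ i, Matrix.toLin' g.1 (e i) ∈ L.1 := fun i => by
    rw [he, mem_span_basis_iff]
    exact ⟨hg i 0, hg i 1⟩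
  rw [smul_val, he, Submodule.map_span, Set.image_pair, ← he, Submodule.span_le]
  rintro x (rfl | rfl)
  · exact h 0
  · exact h 1

theorem smul_le_of_eq_mul {ϖ b : 𝒪[F]} (c : Fˣ) (h : (c : F) = (ϖ * b : 𝒪[F]))
    (M : Submodule 𝒪[F] (Fin 2 → F)) : c • M ≤ ϖ • M := by
  intro x hx
  obtain ⟨y, hy, rfl⟩ := Submodule.mem_smul_pointwise_iff_exists _ _ _ |>.1 hx
  refine Submodule.mem_smul_pointwise_iff_exists _ _ _ |>.2 ⟨b • y, M.smul_mem b hy, ?_⟩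
  rw [smul_smul, Units.smul_def, h]
  rfl

theorem smul_lattice_le_self (ϖ : 𝒪[F]) (M : Submodule 𝒪[F] (Fin 2 → F)) : ϖ • M ≤ M := by
  intro x hx
  obtain ⟨y, hy, rfl⟩ := Submodule.mem_smul_pointwise_iff_exists _ _ _ |>.1 hx
  exact M.smul_mem _ hy

theorem smul_mono_lattice (ϖ : 𝒪[F]) {M N : Submodule 𝒪[F] (Fin 2 → F)} (h : M ≤ N) :
    ϖ • M ≤ ϖ • N := by
  intro x hx
  obtain ⟨y, hy, rfl⟩ := Submodule.mem_smul_pointwise_iff_exists _ _ _ |>.1 hx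
  exact Submodule.mem_smul_pointwise_iff_exists _ _ _ |>.2 ⟨y, h hy, rfl⟩

theorem LatticeAdj.not_ge {L M : Lattice F} (h : LatticeAdj L M) : ¬ L.1 ≤ M.1 := fun hle =>
  h.not_homothetic ⟨1, by rw [one_smul]; exact le_antisymm h.le hle⟩

theorem units_smul_eq_self (u : 𝒪[F]ˣ) (c : Fˣ) (h : (c : F) = (u : 𝒪[F]))
    (M : Submodule 𝒪[F] (Fin 2 → F)) : c • M = M := by
  ext x
  change (∃ y, y ∈ M ∧ c • y = x) ↔ x ∈ M
  constructor
  · rintro ⟨y, hy, rfl⟩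
    rw [Units.smul_def, h]
    exact M.smul_mem (u : 𝒪[F]) hy
  · intro hx
    refine ⟨(↑u⁻¹ : 𝒪[F]) • x, M.smul_mem _ hx, ?_⟩
    rw [Units.smul_def, h]
    change (u : 𝒪[F]) • (↑u⁻¹ : 𝒪[F]) • x = x
    rw [smul_smul, u.mul_inv, one_smul]

theorem latticeAdj_of_basis (e : Module.Basis (Fin 2) F (Fin 2 → F)) {L : Lattice F}
    (hL : L.1 = Submodule.span 𝒪[F] {e 0, e 1}) {ϖ : 𝒪[F]} (hϖ : Irreducible ϖ) :
    ∃ M : Lattice F, M.1 = Submodule.span 𝒪[F] {e 0, ϖ • e 1} ∧ LatticeAdj L M := by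
  have hϖ0 : (ϖ : F) ≠ 0 := fun h0 => hϖ.ne_zero (Subtype.ext h0)
  refine ⟨⟨_, ⟨Submodule.fg_span (Set.toFinite {e 0, ϖ • e 1}), ?_⟩⟩, rfl, e, ϖ, hϖ, hL, rfl⟩
  rw [Submodule.span_span_of_tower, eq_top_iff, ← e.span_eq, Submodule.span_le]
  rintro _ ⟨i, rfl⟩
  have h1 : e 0 ∈ Submodule.span F {e 0, ϖ • e 1} := Submodule.subset_span (by simp)
  have h2 : ϖ • e 1 ∈ Submodule.span F {e 0, ϖ • e 1} := Submodule.subset_span (by simp)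
  fin_cases i
  · exact h1
  · have := Submodule.smul_mem _ (ϖ : F)⁻¹ h2
    rwa [Subring.smul_def, inv_smul_smul₀ hϖ0] at this

variable [TopologicalSpace F] [IsNonarchimedeanLocalField F]

theorem isOpen_integer : IsOpen (𝒪[F] : Set F) := by
  let := IsTopologicalAddGroup.rightUniformSpace F
  have := isUniformAddGroup_of_addCommGroup (G := F)
  exact Valued.isOpen_integer F

theorem isOpen_stabilizer_vertex (s : Vertex F) :
    IsOpen (MulAction.stabilizer PGL(2, F) s : Set PGL(2, F)) := by
  obtain ⟨L, rfl⟩ : ∃ L, Vertex.mk L = s := Quotient.exists_rep s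
  obtain ⟨e, he⟩ := exists_basis_of_lattice L
  have hmk : IsOpen ((Matrix.ProjGenLinGroup.mk : GL (Fin 2) F →* PGL(2, F)) ⁻¹'
      (MulAction.stabilizer PGL(2, F) (Vertex.mk L) : Set PGL(2, F))) := by
    change IsOpen (MulAction.stabilizer (GL (Fin 2) F) (Vertex.mk L) : Set (GL (Fin 2) F))
    refine Subgroup.isOpen_of_mem_nhds _ (g := 1) ?_
    have hcont : ∀ i j, Continuous fun A : Matrix (Fin 2) (Fin 2) F =>
        e.repr (Matrix.toLin' A (e i)) j := fun i j => by
      refine (LinearMap.continuous_on_pi (e.coord j)).comp ?_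
      simp only [Matrix.toLin'_apply]
      fun_prop
    -- If `g` and `g⁻¹` both have integral matrices in the basis `e`, then `g L = L`. This is an
    -- open condition satisfied by `1`.
    let U : Set (GL (Fin 2) F) := ⋂ i, ⋂ j,
      {g | e.repr (Matrix.toLin' g.1 (e i)) j ∈ 𝒪[F]} ∩
        {g | e.repr (Matrix.toLin' (g⁻¹).1 (e i)) j ∈ 𝒪[F]}
    have hU : IsOpen U := isOpen_iInter_of_finite fun i => isOpen_iInter_of_finite fun j =>
      (isOpen_integer.preimage ((hcont i j).comp Units.continuous_val)).inter
        (isOpen_integer.preimage ((hcont i j).comp Units.continuous_coe_inv))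
    refine Filter.mem_of_superset (hU.mem_nhds ?_) fun g hg => ?_
    · have : ∀ i j, e.repr (e i) j ∈ 𝒪[F] := fun i j => by
        rw [e.repr_self_apply]
        split_ifs
        · exact one_mem _
        · exact zero_mem _
      refine Set.mem_iInter.2 fun i => Set.mem_iInter.2 fun j => ⟨?_, ?_⟩ <;>
        simpa only [Set.mem_ofPred_eq, inv_one, Units.val_one, Matrix.toLin'_one, LinearMap.id_apply]
          using this i j
    · have hg' := fun i j => Set.mem_iInter.1 (Set.mem_iInter.1 hg i) j
      change g • Vertex.mk L = Vertex.mk L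
      rw [smul_mk]
      congr 1
      refine Subtype.ext (le_antisymm (smul_lattice_le e he g fun i j => (hg' i j).1) ?_)
      have h := smul_lattice_le e he g⁻¹ fun i j => (hg' i j).2
      have h2 := Submodule.map_mono (f := (Matrix.toLin' g.1).restrictScalars 𝒪[F]) h
      rw [← smul_val, ← smul_val, smul_inv_smul] at h2
      exact h2
  exact isOpen_coinduced.2 hmk

theorem unit_or_dvd {ϖ : 𝒪[F]} (hϖ : Irreducible ϖ) (a : 𝒪[F]) :
    IsUnit a ∨ ∃ b, a = ϖ * b := by
  refine or_iff_not_imp_left.2 fun hu => ?_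
  have : a ∈ IsLocalRing.maximalIdeal 𝒪[F] := hu
  rwa [hϖ.maximalIdeal_eq, Ideal.mem_span_singleton] at this

/-- The three cases are valuation zero, positive and negative. -/
theorem units_trichotomy {ϖ : 𝒪[F]} (hϖ : Irreducible ϖ) (c : Fˣ) :
    (∃ u : 𝒪[F]ˣ, (c : F) = (u : 𝒪[F])) ∨ (∃ b : 𝒪[F], (c : F) = (ϖ * b : 𝒪[F])) ∨
      ∃ b : 𝒪[F], (c : F)⁻¹ = (ϖ * b : 𝒪[F]) := by
  have hcase : (c : F) ∈ 𝒪[F] ∨ (c : F)⁻¹ ∈ 𝒪[F] :=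
    (ValuativeRel.valuation F).valuationSubring.mem_or_inv_mem (c : F)
  rcases hcase with h | h
  · rcases unit_or_dvd hϖ ⟨_, h⟩ with ⟨u, hu⟩ | ⟨b, hb⟩
    · exact Or.inl ⟨u, by rw [hu]⟩
    · exact Or.inr (Or.inl ⟨b, by rw [← hb]⟩)
  · rcases unit_or_dvd hϖ ⟨_, h⟩ with ⟨u, hu⟩ | ⟨b, hb⟩
    · refine Or.inl ⟨u⁻¹, ?_⟩
      have h1 : ((u : 𝒪[F]) : F) = (c : F)⁻¹ := by rw [hu]
      have h2 : ((u : 𝒪[F]) : F) * ((↑u⁻¹ : 𝒪[F]) : F) = 1 := by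
        exact_mod_cast congrArg Subtype.val u.mul_inv
      rw [h1] at h2
      field_simp at h2
      exact h2.symm
    · exact Or.inr (Or.inr ⟨b, by rw [← hb]⟩)

theorem LatticeAdj.exists_basis {ϖ : 𝒪[F]} (hϖ : Irreducible ϖ) {L M : Lattice F}
    (h : LatticeAdj L M) : ∃ e : Module.Basis (Fin 2) F (Fin 2 → F),
      L.1 = Submodule.span 𝒪[F] {e 0, e 1} ∧ M.1 = Submodule.span 𝒪[F] {e 0, ϖ • e 1} := by
  obtain ⟨e, ϖ', hϖ', hL, hM⟩ := h
  obtain ⟨u, hu⟩ := IsDiscreteValuationRing.associated_of_irreducible 𝒪[F] hϖ' hϖ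
  refine ⟨e, hL, ?_⟩
  rw [hM]
  ext x
  rw [Submodule.mem_span_pair, Submodule.mem_span_pair]
  constructor
  · rintro ⟨a, b, rfl⟩
    refine ⟨a, b * ↑u⁻¹, ?_⟩
    rw [← hu, smul_smul, smul_smul]
    congr 2
    linear_combination b * ϖ' * u.mul_inv
  · rintro ⟨a, b, rfl⟩
    refine ⟨a, b * u, ?_⟩
    rw [← hu]
    module

theorem LatticeAdj.not_le_smul {ϖ : 𝒪[F]} (hϖ : Irreducible ϖ) {L M : Lattice F}
    (h : LatticeAdj L M) : ¬ M.1 ≤ ϖ • L.1 := by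
  obtain ⟨e, hL, hM⟩ := h.exists_basis hϖ
  intro hle
  have h0 : e 0 ∈ ϖ • L.1 := hle (hM ▸ Submodule.subset_span (by simp))
  obtain ⟨y, hy, hxy⟩ := Submodule.mem_smul_pointwise_iff_exists _ _ _ |>.1 h0
  rw [hL, mem_span_basis_iff] at hy
  have := congrArg (fun v => e.repr v 0) hxy
  simp only [Subring.smul_def, map_smul, Module.Basis.repr_self] at this
  simp at this
  exact hϖ.not_isUnit (IsUnit.of_mul_eq_one (⟨_, hy.1⟩ : 𝒪[F]) (Subtype.ext this))

/-- The neighbours of a lattice are determined by their homothety classes. -/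
theorem LatticeAdj.eq_of_mk_eq {L M N : Lattice F} (hM : LatticeAdj L M) (hN : LatticeAdj L N)
    (h : Vertex.mk M = Vertex.mk N) : M = N := by
  obtain ⟨ϖ, hϖ⟩ := IsDiscreteValuationRing.exists_irreducible 𝒪[F]
  obtain ⟨c, hc⟩ := Vertex.mk_eq_mk.1 h
  -- A ratio that is not a unit would put one of the two neighbours inside `ϖ L`.
  rcases units_trichotomy hϖ c with ⟨u, hu⟩ | ⟨b, hb⟩ | ⟨b, hb⟩
  · exact Subtype.ext (by rw [hc, units_smul_eq_self u c hu])
  · refine absurd ?_ (hN.not_le_smul hϖ)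
    rw [hc]
    exact (smul_le_of_eq_mul c hb _).trans (smul_mono_lattice ϖ hM.le)
  · refine absurd ?_ (hM.not_le_smul hϖ)
    rw [← inv_smul_smul c M.1, ← hc]
    exact (smul_le_of_eq_mul c⁻¹ (by simpa using hb) _).trans (smul_mono_lattice ϖ hN.le)

/-- If `N = c L`, then `c` in the maximal ideal gives `N ⊆ ϖ L`, and otherwise `c⁻¹` is integral and
`L ⊆ N`. -/
theorem mk_ne_mk_of_not_le {ϖ : 𝒪[F]} (hϖ : Irreducible ϖ) {L N : Lattice F}
    (h1 : ¬ L.1 ≤ N.1) (h2 : ¬ N.1 ≤ ϖ • L.1) : Vertex.mk L ≠ Vertex.mk N := by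
  intro h
  obtain ⟨c, hc⟩ := Vertex.mk_eq_mk.1 h
  rcases units_trichotomy hϖ c with ⟨u, hu⟩ | ⟨b, hb⟩ | ⟨b, hb⟩
  · exact h1 (by rw [hc, units_smul_eq_self u c hu])
  · exact h2 (hc ▸ smul_le_of_eq_mul c hb _)
  · refine h1 ?_
    rw [← inv_smul_smul c L.1, ← hc]
    exact (smul_le_of_eq_mul c⁻¹ (by simpa using hb) _).trans (smul_lattice_le_self _ _)

theorem LatticeAdj.uniformizer_symm {ϖ : 𝒪[F]} (hϖ : Irreducible ϖ) {L M : Lattice F}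
    (h : LatticeAdj L M) :
    ∃ L' : Lattice F, L'.1 = ϖ • L.1 ∧ Vertex.mk L' = Vertex.mk L ∧ LatticeAdj M L' := by
  obtain ⟨e, hL, hM⟩ := h.exists_basis hϖ
  have hϖ0 : (ϖ : F) ≠ 0 := fun h0 => hϖ.ne_zero (Subtype.ext h0)
  let c : Fˣ := Units.mk0 (ϖ : F) hϖ0
  refine ⟨Matrix.GeneralLinearGroup.scalar (Fin 2) c • L, ?_, mk_smul_lattice c L,
    (e.unitsSMul ![1, c]).reindex (Equiv.swap 0 1), ϖ, hϖ, ?_, ?_⟩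
  · rw [scalar_smul_val]
    rfl
  · rw [hM, Set.pair_comm]
    simp [Module.Basis.unitsSMul_apply]
    rfl
  · rw [scalar_smul_val, hL]
    change Submodule.map _ _ = _
    rw [Submodule.map_span, Set.image_pair, Set.pair_comm]
    simp [Module.Basis.unitsSMul_apply]
    rfl

/-- Along a path without backtracking, the lattices of a decreasing chain of representatives are
not contained in `ϖ L`. -/
theorem exists_lattice_chain {ϖ : 𝒪[F]} (hϖ : Irreducible ϖ) (L : Lattice F) (n : ℕ)
    (s : ℕ → Vertex F) (h0 : Vertex.mk L = s 0) (hadj : ∀ i < n + 1, (tree F).Adj (s i) (s (i + 1)))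
    (hne : ∀ i < n, s i ≠ s (i + 2)) :
    ∃ M N : Lattice F, Vertex.mk M = s n ∧ Vertex.mk N = s (n + 1) ∧ LatticeAdj M N ∧
      M.1 ≤ L.1 ∧ ¬ L.1 ≤ N.1 ∧ ¬ N.1 ≤ ϖ • L.1 := by
  induction n with
  | zero =>
    have := hadj 0 (by omega)
    rw [← h0] at this
    obtain ⟨M, hM, h⟩ := LatticeAdj.exists_of_adj this
    exact ⟨L, M, h0, hM, h, le_rfl, h.not_ge, h.not_le_smul hϖ⟩
  | succ n ih =>
    obtain ⟨M, N, hM, hN, hMN, h1, h2, h3⟩ := ih (fun i hi => hadj i (by omega))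
      (fun i hi => hne i (by omega))
    have := hadj (n + 1) (by omega)
    rw [← hN] at this
    obtain ⟨N', hN', h⟩ := LatticeAdj.exists_of_adj this
    obtain ⟨M', hM', hmk, hNM'⟩ := hMN.uniformizer_symm hϖ
    refine ⟨N, N', hN, hN', h, hMN.le.trans h1, fun hc => h2 (hc.trans h.le), fun hc => h3 ?_⟩
    -- Here `M' = ϖ M` and `N'` are both maximal sublattices of `N`; an inclusion would make them
    -- equal, that is, the path would backtrack.
    have hMn : ¬ N'.1 ≤ M'.1 := by
      intro hle
      rcases h.eq_or_eq hle hNM'.le with h' | h'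
      · refine hne n (by omega) ?_
        rw [← hM, ← hmk, ← hN', Subtype.ext h']
      · exact hNM'.not_ge h'.ge
    -- Hence `N' + ϖ M = N`. As `ϖ M ⊆ ϖ L`, an inclusion `N' ⊆ ϖ L` would give `N ⊆ ϖ L`, against
    -- the induction hypothesis.
    rcases hNM'.eq_or_eq (N := N'.1 ⊔ M'.1) le_sup_right (sup_le h.le hNM'.le) with h' | h'
    · exact absurd (h' ▸ le_sup_left) hMn
    · rw [← h', hM']
      exact sup_le hc (smul_mono_lattice ϖ h1)

/-- A sequence of adjacent vertices without backtracking does not return to its origin. -/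
theorem ne_of_nonbacktracking (n : ℕ) (s : ℕ → Vertex F)
    (hadj : ∀ i < n + 1, (tree F).Adj (s i) (s (i + 1))) (hne : ∀ i < n, s i ≠ s (i + 2)) :
    s 0 ≠ s (n + 1) := by
  obtain ⟨ϖ, hϖ⟩ := IsDiscreteValuationRing.exists_irreducible 𝒪[F]
  obtain ⟨L, hL⟩ : ∃ L, Vertex.mk L = s 0 := Quotient.exists_rep (s 0)
  obtain ⟨M, N, -, hN, -, -, h2, h3⟩ := exists_lattice_chain hϖ L n s hL hadj hne
  rw [← hL, ← hN]
  exact mk_ne_mk_of_not_le hϖ h2 h3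

/-- Every vertex has at least three neighbours. -/
theorem exists_adj_ne_ne (s t t' : Vertex F) : ∃ x, (tree F).Adj s x ∧ x ≠ t ∧ x ≠ t' := by
  obtain ⟨L, rfl⟩ : ∃ L, Vertex.mk L = s := Quotient.exists_rep s
  obtain ⟨e, he⟩ := exists_basis_of_lattice L
  obtain ⟨ϖ, hϖ⟩ := IsDiscreteValuationRing.exists_irreducible 𝒪[F]
  have hli : LinearIndependent F ![e 0 + e 1, e 1] := by
    have := e.linearIndependent
    rw [LinearIndependent.pair_iff]
    intro a b hab
    have h0 := congrArg (fun v => e.repr v 0) hab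
    have h1 := congrArg (fun v => e.repr v 1) hab
    simp at h0 h1
    subst h0
    simpa using h1
  let f : Module.Basis (Fin 2) F (Fin 2 → F) :=
    basisOfLinearIndependentOfCardEqFinrank hli (by simp)
  have hf0 : f 0 = e 0 + e 1 := by simp [f]
  have hf1 : f 1 = e 1 := by simp [f]
  have hf : L.1 = Submodule.span 𝒪[F] {f 0, f 1} := by
    rw [he, hf0, hf1]
    ext x
    simp only [Submodule.mem_span_pair]
    constructor
    · rintro ⟨a, b, rfl⟩
      exact ⟨a, b - a, by module⟩
    · rintro ⟨a, b, rfl⟩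
      exact ⟨a, b + a, by module⟩
  have hswap : L.1 = Submodule.span 𝒪[F] {(e.reindex (Equiv.swap 0 1)) 0,
      (e.reindex (Equiv.swap 0 1)) 1} := by
    rw [he, Set.pair_comm]
    simp
  -- The three neighbours correspond to the lines of `L / ϖ L` spanned by `e 0`, `e 1` and `e 0 + e
  -- 1`. A neighbour containing two of these vectors would contain `L`.
  obtain ⟨M₀, h₀, a₀⟩ := latticeAdj_of_basis e he hϖ
  obtain ⟨M₁, h₁, a₁⟩ := latticeAdj_of_basis _ hswap hϖ
  obtain ⟨M₂, h₂, a₂⟩ := latticeAdj_of_basis f hf hϖ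
  have key : ∀ {M N : Lattice F}, LatticeAdj L M → LatticeAdj L N →
      (M = N → e 0 ∈ M.1 ∧ e 1 ∈ M.1) → Vertex.mk M ≠ Vertex.mk N := by
    intro M N hM hN h hmk
    obtain ⟨h0, h1⟩ := h (hM.eq_of_mk_eq hN hmk)
    refine hM.not_ge ?_
    rw [he, Submodule.span_le]
    rintro x (rfl | rfl)
    exacts [h0, h1]
  have m₀ : e 0 ∈ M₀.1 := h₀ ▸ Submodule.subset_span (by simp)
  have m₁ : e 1 ∈ M₁.1 := h₁ ▸ Submodule.subset_span (by simp)
  have m₂ : e 0 + e 1 ∈ M₂.1 := by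
    rw [h₂, ← hf0]
    exact Submodule.subset_span (by simp)
  have n₀₁ := key a₀ a₁ fun h => ⟨m₀, h ▸ m₁⟩
  have n₀₂ := key a₀ a₂ fun h => ⟨m₀, by
    have := M₀.1.sub_mem (h ▸ m₂ : e 0 + e 1 ∈ M₀.1) m₀
    rwa [add_sub_cancel_left] at this⟩
  have n₁₂ := key a₁ a₂ fun h => ⟨by
    have := M₁.1.sub_mem (h ▸ m₂ : e 0 + e 1 ∈ M₁.1) m₁
    rwa [add_sub_cancel_right] at this, m₁⟩
  have adj : ∀ {M}, LatticeAdj L M → (tree F).Adj (Vertex.mk L) (Vertex.mk M) :=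
    fun h => ⟨_, _, rfl, rfl, h⟩
  by_cases c₀ : Vertex.mk M₀ ≠ t ∧ Vertex.mk M₀ ≠ t'
  · exact ⟨_, adj a₀, c₀⟩
  by_cases c₁ : Vertex.mk M₁ ≠ t ∧ Vertex.mk M₁ ≠ t'
  · exact ⟨_, adj a₁, c₁⟩
  refine ⟨_, adj a₂, ?_⟩
  grind

end BruhatTits

/-! ### Oriented paths: extension, finiteness, functions on them -/

namespace BruhatTits

variable {F : Type u} [Field F] [ValuativeRel F]

namespace OrientedPath

theorem tail_vertex {n : ℕ} (a : OrientedPath F (n + 1)) (i : Fin (n + 1)) :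
    a.tail.vertex i = a.vertex i.succ := rfl

/-- The path run backwards. -/
def reverse {n : ℕ} (a : OrientedPath F n) : OrientedPath F n where
  vertex i := a.vertex i.rev
  injective := a.injective.comp Fin.rev_injective
  adj i := by
    rw [Fin.rev_castSucc, Fin.rev_succ]
    exact (a.adj i.rev).symm

theorem reverse_reverse {n : ℕ} (a : OrientedPath F n) : a.reverse.reverse = a :=
  OrientedPath.ext (funext fun i => congrArg a.vertex (Fin.rev_rev i))

/-- Reversal exchanges the two end points of an edge, so that results pass between `init` and
`tail`. -/
theorem init_reverse {n : ℕ} (a : OrientedPath F (n + 1)) : a.reverse.init = a.tail.reverse :=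
  OrientedPath.ext (funext fun i => congrArg a.vertex (Fin.rev_castSucc i))

/-- The path `(x, w₀, …, w_n)`. -/
def cons {n : ℕ} (x : Vertex F) (w : OrientedPath F n) (hx : (tree F).Adj x (w.vertex 0))
    (hne : ∀ i, x ≠ w.vertex i) : OrientedPath F (n + 1) where
  vertex := Fin.cons x w.vertex
  injective := Fin.cons_injective_iff.2 ⟨fun ⟨i, hi⟩ => hne i hi.symm, w.injective⟩
  adj i := by
    cases i using Fin.cases with
    | zero => exact hx
    | succ i => exact w.adj i

theorem tail_cons {n : ℕ} (x : Vertex F) (w : OrientedPath F n) (hx) (hne) :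
    (cons x w hx hne).tail = w := rfl

theorem init_cons_congr {n : ℕ} (x : Vertex F) {w w' : OrientedPath F (n + 1)}
    (h : w.init = w'.init) (hx) (hne) (hx') (hne') :
    (cons x w hx hne).init = (cons x w' hx' hne').init := by
  refine OrientedPath.ext (funext fun i => ?_)
  cases i using Fin.cases with
  | zero => rfl
  | succ i => exact congrArg (fun a => OrientedPath.vertex a i) h

variable [TopologicalSpace F] [IsNonarchimedeanLocalField F]

/-- Since paths without backtracking never return, avoiding the second vertex of `w` is enough for
`x` to extend `w` to an injective path. -/
theorem ne_vertex_of_adj {n : ℕ} (x : Vertex F) (w : OrientedPath F (n + 1))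
    (hx : (tree F).Adj x (w.vertex 0)) (hne : x ≠ w.vertex 1) (i : Fin (n + 2)) :
    x ≠ w.vertex i := by
  -- The sequence `x, w₀, w₁, …`; its values beyond the end of `w` are never used.
  let s : ℕ → Vertex F := fun j =>
    Nat.casesOn j x fun j => w.vertex (if h : j < n + 2 then ⟨j, h⟩ else 0)
  have hs : ∀ j (h : j < n + 2), s (j + 1) = w.vertex ⟨j, h⟩ := fun j h => by simp [s, h]
  have := ne_of_nonbacktracking i.val s ?_ ?_
  · rwa [hs i.val i.isLt] at this
  · rintro (_ | j) hj
    · rw [hs 0 (by omega)]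
      exact hx
    · rw [hs j (by omega), hs (j + 1) (by omega)]
      exact w.adj ⟨j, by omega⟩
  · rintro (_ | j) hj
    · rw [hs 1 (by omega)]
      exact hne
    · rw [hs j (by omega), hs (j + 2) (by omega)]
      exact fun h => by simpa using w.injective h

theorem tail_surjective (n : ℕ) :
    Function.Surjective (OrientedPath.tail : OrientedPath F (n + 1) → OrientedPath F n) := by
  intro w
  cases n with
  | zero =>
    obtain ⟨x, hx, -⟩ := exists_adj_ne_ne (w.vertex 0) (w.vertex 0) (w.vertex 0)
    refine ⟨cons x w hx.symm fun i => ?_, rfl⟩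
    rw [Fin.fin_one_eq_zero i]
    exact hx.ne'
  | succ n =>
    obtain ⟨x, hx, hne, -⟩ := exists_adj_ne_ne (w.vertex 0) (w.vertex 1) (w.vertex 1)
    exact ⟨cons x w hx.symm (ne_vertex_of_adj x w hx.symm hne), rfl⟩

theorem init_surjective (n : ℕ) :
    Function.Surjective (OrientedPath.init : OrientedPath F (n + 1) → OrientedPath F n) := by
  intro w
  obtain ⟨a, ha⟩ := tail_surjective n w.reverse
  exact ⟨a.reverse, by rw [init_reverse, ha, reverse_reverse]⟩

theorem finite_init_fiber {n : ℕ} (w : OrientedPath F n) :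
    {a : OrientedPath F (n + 1) | a.init = w}.Finite := by
  refine Set.Finite.of_finite_image (f := fun a => a.vertex (Fin.last _))
    ((finite_neighbors (w.vertex (Fin.last n))).subset ?_) ?_
  · rintro _ ⟨a, rfl, rfl⟩
    exact a.adj (Fin.last n)
  · intro a ha b hb h
    refine OrientedPath.ext (funext fun i => ?_)
    cases i using Fin.lastCases with
    | last => exact h
    | cast i =>
      have hab : a.init = b.init := ha.trans hb.symm
      exact congrArg (fun c => OrientedPath.vertex c i) hab

theorem finite_tail_fiber {n : ℕ} (w : OrientedPath F n) :
    {a : OrientedPath F (n + 1) | a.tail = w}.Finite := by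
  refine ((finite_init_fiber w.reverse).image reverse).subset ?_
  rintro a rfl
  exact ⟨a.reverse, init_reverse a, reverse_reverse a⟩

theorem finite_init_preimage {n : ℕ} {S : Set (OrientedPath F n)} (hS : S.Finite) :
    {a : OrientedPath F (n + 1) | a.init ∈ S}.Finite :=
  hS.preimage' fun b _ => finite_init_fiber b

theorem finite_tail_preimage {n : ℕ} {S : Set (OrientedPath F n)} (hS : S.Finite) :
    {a : OrientedPath F (n + 1) | a.tail ∈ S}.Finite :=
  hS.preimage' fun b _ => finite_tail_fiber b

theorem finite_vertex_eq {n : ℕ} (i : Fin (n + 1)) (s : Vertex F) :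
    {a : OrientedPath F n | a.vertex i = s}.Finite := by
  induction n with
  | zero =>
    refine Set.Subsingleton.finite fun a ha b hb => OrientedPath.ext (funext fun j => ?_)
    obtain rfl : j = i := by lia
    exact ha.trans hb.symm
  | succ n ih =>
    cases i using Fin.cases with
    | zero => exact finite_init_preimage (ih 0)
    | succ i => exact finite_tail_preimage (ih i)

/-- Functions that are constant on the connected components of the fibres come from the common
part of the edges of each component. -/
theorem exists_eq_comp_init_tail {n : ℕ} {f h : OrientedPath F (n + 1) → ℂ}
    (hfh : ∀ a : OrientedPath F (n + 2), f a.tail = h a.init) :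
    ∃ φ : OrientedPath F n → ℂ, (∀ v, f v = φ v.init) ∧ ∀ v, h v = φ v.tail := by
  have key : ∀ w w' : OrientedPath F (n + 1), w.init = w'.init → f w = f w' := by
    intro w w' hw
    have h0 : w.vertex 0 = w'.vertex 0 := congrArg (fun a : OrientedPath F n => a.vertex 0) hw
    -- A common `x` extends both `w` and `w'` at the front, and the two extensions have the same
    -- `init`. A third neighbour is needed because `w` and `w'` may differ at index `1` when `n =
    -- 0`.
    obtain ⟨x, hx, h1, h1'⟩ := exists_adj_ne_ne (w.vertex 0) (w.vertex 1) (w'.vertex 1)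
    have e := init_cons_congr x hw hx.symm (ne_vertex_of_adj x w hx.symm h1)
      (h0 ▸ hx.symm) (ne_vertex_of_adj x w' (h0 ▸ hx.symm) h1')
    rw [← tail_cons x w hx.symm (ne_vertex_of_adj x w hx.symm h1), hfh, e, ← hfh, tail_cons]
  choose r hr using init_surjective (F := F) n
  -- The value `φ z` is that of `f` on any extension of `z` at the end. For `v = a.init`, the path
  -- `a.tail` is such an extension of `v.tail`, and `f a.tail = h v`.
  refine ⟨fun z => f (r z), fun v => key _ _ (hr _).symm, fun v => ?_⟩
  obtain ⟨a, rfl⟩ := init_surjective (n + 1) v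
  rw [← hfh]
  exact key _ _ (hr _).symm

theorem isOpen_stabilizer {n : ℕ} (a : OrientedPath F n) :
    IsOpen (MulAction.stabilizer PGL(2, F) a : Set PGL(2, F)) := by
  have : (MulAction.stabilizer PGL(2, F) a : Set PGL(2, F)) =
      ⋂ i, (MulAction.stabilizer PGL(2, F) (a.vertex i) : Set PGL(2, F)) := by
    ext g
    simp only [SetLike.mem_coe, MulAction.mem_stabilizer_iff, Set.mem_iInter]
    exact OrientedPath.ext_iff.trans funext_iff
  rw [this]
  exact isOpen_iInter_of_finite fun i => isOpen_stabilizer_vertex _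

end OrientedPath

end BruhatTits

/-! ### Complete reducibility over a finite set -/

/-- Over a finite set, an invariant space of functions has an equivariant lift of the quotient:
the orthogonal complement is invariant. -/
theorem exists_equivariant_lift {H : Type*} [Group H] {S : Type*} [MulAction H S] [Finite S]
    (B : Submodule ℂ (finSupp S))
    (hB : ∀ h : H, B ≤ B.comap ((funRep H S).subrepresentation (finSupp S)
      (finSupp_le_comap H S) h)) :
    ∃ j : (finSupp S ⧸ B) →ₗ[ℂ] finSupp S, (∀ x, B.mkQ (j x) = x) ∧
      ∀ (h : H) (x : finSupp S ⧸ B),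
        j (((funRep H S).subrepresentation (finSupp S) (finSupp_le_comap H S)).quotient B hB h x) =
          (funRep H S).subrepresentation (finSupp S) (finSupp_le_comap H S) h (j x) := by
  have := Fintype.ofFinite S
  let ρ := (funRep H S).subrepresentation (finSupp S) (finSupp_le_comap H S)
  let e : finSupp S ≃ₗ[ℂ] EuclideanSpace ℂ S :=
    (LinearEquiv.ofTop (finSupp S) (eq_top_iff.2 fun f _ => Set.toFinite _)).trans
      (WithLp.linearEquiv 2 ℂ (S → ℂ)).symm
  have he : ∀ f s, e f s = f.1 s := fun f s => rfl
  -- `H` permutes `S`, so the standard Hermitian product is invariant.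
  have hinner : ∀ h f g, inner ℂ (e (ρ h f)) (e g) = inner ℂ (e f) (e (ρ h⁻¹ g)) := by
    intro h f g
    simp only [PiLp.inner_apply, he]
    refine Fintype.sum_equiv (MulAction.toPerm h⁻¹) _ _ fun s => ?_
    change inner ℂ (f.1 (h⁻¹ • s)) (g.1 s) = inner ℂ (f.1 (h⁻¹ • s)) (g.1 (h⁻¹⁻¹ • h⁻¹ • s))
    rw [inv_inv, smul_inv_smul]
  let C : Submodule ℂ (finSupp S) := (B.map e.toLinearMap)ᗮ.comap e.toLinearMap
  have hC : ∀ f, f ∈ C ↔ ∀ b ∈ B, inner ℂ (e b) (e f) = 0 := by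
    intro f
    change e f ∈ (B.map e.toLinearMap)ᗮ ↔ _
    rw [Submodule.mem_orthogonal]
    exact ⟨fun h b hb => h _ ⟨b, hb, rfl⟩, by rintro h _ ⟨b, hb, rfl⟩; exact h b hb⟩
  have hCρ : ∀ h f, f ∈ C → ρ h f ∈ C := by
    intro h f hf
    rw [hC] at hf ⊢
    intro b hb
    have h1 := hinner h⁻¹ b f
    rw [inv_inv] at h1
    rw [← h1]
    exact hf _ (hB h⁻¹ hb)
  have hcompl : IsCompl B C := by
    have h1 : IsCompl (B.map e.toLinearMap) (B.map e.toLinearMap)ᗮ :=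
      Submodule.isCompl_orthogonal _
    have h2 : IsCompl ((B.map e.toLinearMap).comap e.toLinearMap) C :=
      (Submodule.orderIsoMapComap e).symm.isCompl h1
    rwa [Submodule.comap_map_eq_of_injective e.injective] at h2
  let q := Submodule.quotientEquivOfIsCompl B C hcompl
  have hq : ∀ x, B.mkQ (q x : finSupp S) = x := fun x =>
    Submodule.mk_quotientEquivOfIsCompl_apply hcompl x
  refine ⟨C.subtype ∘ₗ q.toLinearMap, hq, fun h x => ?_⟩
  -- The two sides lift the same class, so their difference lies in `B`; it also lies in `C`.
  refine sub_eq_zero.1 ((Submodule.disjoint_def.1 hcompl.disjoint) _ ?_ ?_)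
  · refine (Submodule.Quotient.mk_eq_zero B).1 ?_
    rw [Submodule.Quotient.mk_sub, sub_eq_zero]
    refine (hq _).trans ?_
    conv_lhs => rw [← hq x]
    rfl
  · exact C.sub_mem (q _).2 (hCρ h _ (q x).2)

/-! ### The pull-back map and the splitting criterion -/

namespace BruhatTits

variable {F : Type u} [Field F] [ValuativeRel F] [TopologicalSpace F] [IsNonarchimedeanLocalField F]

namespace OrientedPath

theorem comp_init_mem_finSupp {n : ℕ} {f : OrientedPath F n → ℂ} (hf : f ∈ finSupp _) :
    (fun a : OrientedPath F (n + 1) => f a.init) ∈ finSupp (OrientedPath F (n + 1)) :=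
  finite_init_preimage (S := Function.support f) hf

theorem mem_finSupp_of_comp_init {n : ℕ} {φ : OrientedPath F n → ℂ}
    (h : (fun a : OrientedPath F (n + 1) => φ a.init) ∈ finSupp (OrientedPath F (n + 1))) :
    φ ∈ finSupp _ := by
  refine (Set.Finite.image OrientedPath.init h).subset fun z hz => ?_
  obtain ⟨a, rfl⟩ := init_surjective n z
  exact ⟨a, hz, rfl⟩

end OrientedPath

open OrientedPath

theorem mk_eq_zero_iff {V E : Type*} (Γ : DirectedGraph V E) (w : finSupp E) :
    (Submodule.Quotient.mk w : Γ.H1c) = 0 ↔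
      ∃ f ∈ finSupp V, ∀ a, w.1 a = f (Γ.head a) - f (Γ.tail a) := by
  rw [Submodule.Quotient.mk_eq_zero]
  change (∃ f, f ∈ finSupp V ∧ Γ.coboundary f = w.1) ↔ _
  refine exists_congr fun f => and_congr_right fun _ => ?_
  rw [eq_comm, funext_iff]
  rfl

/-- Pull-back of cochains along `a ↦ a⁻`. -/
def initPullback (F : Type u) [Field F] [ValuativeRel F] [TopologicalSpace F]
    [IsNonarchimedeanLocalField F] (n : ℕ) :
    finSupp (OrientedPath F n) →ₗ[ℂ] finSupp (OrientedPath F (n + 1)) where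
  toFun f := ⟨fun a => f.1 a.init, comp_init_mem_finSupp f.2⟩
  map_add' _ _ := rfl
  map_smul' _ _ := rfl

theorem coboundaries_le_initPullback (n : ℕ) :
    (tildeX F n).coboundaries ≤ ((tildeX F (n + 1)).coboundaries).comap (initPullback F (n + 1)) := by
  intro w hw
  rw [← Submodule.Quotient.mk_eq_zero, mk_eq_zero_iff] at hw
  rw [Submodule.mem_comap, ← Submodule.Quotient.mk_eq_zero, mk_eq_zero_iff]
  obtain ⟨f, hf, hfw⟩ := hw
  exact ⟨fun v => f v.init, comp_init_mem_finSupp hf, fun a => hfw a.init⟩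

/-- The map `H¹_c(X̃ₙ) → H¹_c(X̃ₙ₊₁)` induced by `a ↦ a⁻`. -/
def initMap (F : Type u) [Field F] [ValuativeRel F] [TopologicalSpace F]
    [IsNonarchimedeanLocalField F] (n : ℕ) :
    Representation.IntertwiningMap ((tildeX F n).H1cRep (tildeX_isInvariant n))
      ((tildeX F (n + 1)).H1cRep (tildeX_isInvariant (n + 1))) where
  toLinearMap := Submodule.mapQ _ _ (initPullback F (n + 1)) (coboundaries_le_initPullback n)
  isIntertwining' g := by
    refine Submodule.linearMap_qext _ ?_
    rfl

theorem initMap_mk {n : ℕ} (w : finSupp (OrientedPath F (n + 1))) :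
    initMap F n (Submodule.Quotient.mk w : (tildeX F n).H1c) =
      (Submodule.Quotient.mk (initPullback F (n + 1) w) : (tildeX F (n + 1)).H1c) := rfl

/-- If `w(a⁻) = df(a)`, then `f(a⁺) = (f + w)(a⁻)`, so `f` and `f + w` come from one function `φ`
through `init` and `tail`. Their difference is `w = dφ`, and `φ` has finite support because every
path extends. -/
theorem initMap_injective (n : ℕ) : Function.Injective (initMap F n) := by
  rw [injective_iff_map_eq_zero]
  intro x hx
  obtain ⟨w, rfl⟩ := Submodule.Quotient.mk_surjective _ x
  rw [initMap_mk, mk_eq_zero_iff] at hx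
  obtain ⟨f, hf, hfw⟩ := hx
  obtain ⟨φ, hφ, hφ'⟩ := exists_eq_comp_init_tail (f := f) (h := fun v => f v + w.1 v) fun a =>
    (eq_add_of_sub_eq' (hfw a).symm)
  rw [mk_eq_zero_iff]
  refine ⟨φ, mem_finSupp_of_comp_init ?_, fun a => ?_⟩
  · convert hf using 1
    exact funext fun v => (hφ v).symm
  · have := hφ' a
    rw [hφ] at this
    exact eq_sub_of_add_eq' this

/-- A retract of `H¹_c(X̃ₙ₊₁)` by an intertwining map whose kernel consists of the classes of the
cochains `f (a⁺) - h (a⁻)` has `H¹_c(X̃ₙ)` as a complement. -/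
theorem nonempty_equiv_prod {n n' : ℕ} (hn : n' = n + 1) {W : Type*} [AddCommGroup W] [Module ℂ W]
    (τ : Representation ℂ PGL(2, F) W)
    (ρ : Representation.IntertwiningMap ((tildeX F n').H1cRep (tildeX_isInvariant n')) τ)
    (σ : Representation.IntertwiningMap τ ((tildeX F n').H1cRep (tildeX_isInvariant n')))
    (hρσ : ∀ w, ρ (σ w) = w)
    (hker : ∀ w : finSupp (OrientedPath F (n' + 1)),
      ρ (Submodule.Quotient.mk w : (tildeX F n').H1c) = 0 ↔
        ∃ f ∈ finSupp (OrientedPath F n'), ∃ h ∈ finSupp (OrientedPath F n'),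
          ∀ a, w.1 a = f a.tail - h a.init) :
    Nonempty (Representation.Equiv ((tildeX F n').H1cRep (tildeX_isInvariant n'))
      (((tildeX F n).H1cRep (tildeX_isInvariant n)).prod τ)) := by
  -- The separate variable `n'` serves the application, where `2m - 1` and `(2m - 2) + 1` are equal
  -- only for `m ≥ 1`.
  subst hn
  have h0 : ∀ y, ρ (initMap F n y) = 0 := by
    intro y
    obtain ⟨w, rfl⟩ := Submodule.Quotient.mk_surjective _ y
    rw [initMap_mk, hker]
    exact ⟨0, zero_mem _, -w.1, neg_mem w.2, fun a => by simp [initPullback]⟩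
  let T := LinearMap.coprod (initMap F n).toLinearMap σ.toLinearMap
  have hT : ∀ y z, T (y, z) = initMap F n y + σ z := fun y z => rfl
  have hbij : Function.Bijective T := by
    constructor
    · rw [injective_iff_map_eq_zero]
      rintro ⟨y, z⟩ hyz
      rw [hT] at hyz
      have hz : z = 0 := by
        have := congrArg ρ hyz
        rwa [map_add, h0, hρσ, zero_add, map_zero] at this
      subst hz
      rw [map_zero, add_zero] at hyz
      rw [initMap_injective n (hyz.trans (map_zero _).symm)]
      rfl
    · intro x
      obtain ⟨w, hw⟩ := Submodule.Quotient.mk_surjective _ (x - σ (ρ x))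
      have h1 : ρ (Submodule.Quotient.mk w : (tildeX F (n + 1)).H1c) = 0 := by
        rw [hw, map_sub, hρσ, sub_self]
      obtain ⟨f, hf, h, hh, hfh⟩ := (hker w).1 h1
      -- The cochain `f(a⁺) - h(a⁻)` differs from the pull-back of `f - h` by `df`.
      refine ⟨(Submodule.Quotient.mk ⟨f - h, sub_mem hf hh⟩, ρ x), ?_⟩
      rw [hT, initMap_mk, ← eq_sub_iff_add_eq, ← hw, eq_comm, ← sub_eq_zero,
        ← Submodule.Quotient.mk_sub, mk_eq_zero_iff]
      refine ⟨f, hf, fun a => ?_⟩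
      change w.1 a - (f a.init - h a.init) = f a.tail - f a.init
      rw [hfh]
      ring
  refine ⟨(Representation.Equiv.mk (LinearEquiv.ofBijective T hbij) fun g => ?_).symm⟩
  refine LinearMap.ext fun ⟨y, z⟩ => ?_
  change initMap F n _ + σ (τ g z) =
    (tildeX F (n + 1)).H1cRep (tildeX_isInvariant (n + 1)) g (initMap F n y + σ z)
  rw [map_add, ← (initMap F n).isIntertwining, ← σ.isIntertwining]
  rfl

end BruhatTits

/-! ### Restriction to the fibres and compact induction -/

namespace BruhatTits

variable {F : Type u} [Field F] [ValuativeRel F]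

section Restriction

variable (m : ℕ) (s : Vertex F)

/-- Restriction of a cochain to the edges above a vertex. -/
def fibreRestrict : finSupp (OrientedPath F (2 * m - 1 + 1)) →ₗ[ℂ] finSupp (FibreEdge m s) where
  toFun w := ⟨fun a => w.1 a.1, Set.Finite.preimage Subtype.val_injective.injOn w.2⟩
  map_add' _ _ := rfl
  map_smul' _ _ := rfl

theorem coboundaries_le_fibreRestrict :
    (tildeX F (2 * m - 1)).coboundaries ≤ (fibre m s).coboundaries.comap (fibreRestrict m s) := by
  intro w hw
  rw [← Submodule.Quotient.mk_eq_zero, mk_eq_zero_iff] at hw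
  rw [Submodule.mem_comap, ← Submodule.Quotient.mk_eq_zero, mk_eq_zero_iff]
  obtain ⟨f, hf, hfw⟩ := hw
  exact ⟨fun v => f v.1, Set.Finite.preimage Subtype.val_injective.injOn hf, fun a => hfw a.1⟩

/-- The restriction map in cohomology. -/
def fibreMap : (tildeX F (2 * m - 1)).H1c →ₗ[ℂ] (fibre m s).H1c :=
  Submodule.mapQ _ _ (fibreRestrict m s) (coboundaries_le_fibreRestrict m s)

theorem fibreMap_stabilizer (k : MulAction.stabilizer PGL(2, F) s)
    (x : (tildeX F (2 * m - 1)).H1c) :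
    fibreMap m s ((tildeX F (2 * m - 1)).H1cRep (tildeX_isInvariant (2 * m - 1)) k.1 x) =
      (fibre m s).H1cRep (fibre_isInvariant m s) k (fibreMap m s x) := by
  obtain ⟨w, rfl⟩ := Submodule.Quotient.mk_surjective _ x
  rfl

/-- The middle vertex of an edge of `X̃_{2m-1}`. -/
def middle (m : ℕ) (a : OrientedPath F (2 * m - 1 + 1)) : Vertex F := a.vertex ⟨m, by omega⟩

theorem middle_smul (g : PGL(2, F)) (a : OrientedPath F (2 * m - 1 + 1)) :
    middle m (g • a) = g • middle m a := rfl

/-- Extension by zero of a cochain on the edges above `s`. -/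
def extendZero : (FibreEdge m s → ℂ) →ₗ[ℂ] (OrientedPath F (2 * m - 1 + 1) → ℂ) :=
  Function.ExtendByZero.linearMap ℂ Subtype.val

variable {m s}

theorem extendZero_apply (w : FibreEdge m s → ℂ) (a : FibreEdge m s) :
    extendZero m s w a.1 = w a :=
  Subtype.val_injective.extend_apply _ _ _

theorem extendZero_smul (k : MulAction.stabilizer PGL(2, F) s) (w : FibreEdge m s → ℂ)
    {a : OrientedPath F (2 * m - 1 + 1)} (ha : middle m a = s) :
    extendZero m s (funRep _ (FibreEdge m s) k w) (k.1 • a) = extendZero m s w a := by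
  let b : FibreEdge m s := ⟨a, ha⟩
  have h1 := extendZero_apply (funRep _ (FibreEdge m s) k w) (k • b)
  have h2 := extendZero_apply w b
  refine h1.trans (Eq.trans ?_ h2.symm)
  change w (k⁻¹ • k • b) = w b
  rw [inv_smul_smul]

end Restriction

variable [TopologicalSpace F] [IsNonarchimedeanLocalField F]

instance (m : ℕ) (s : Vertex F) : Finite (FibreEdge m s) :=
  (OrientedPath.finite_vertex_eq _ s).to_subtype

/-- The finitely many paths in the support have open stabilizers, and an element fixing them all
fixes `w`. This gives smoothness in the induced representation. -/
theorem exists_isOpen_stabilizer_finSupp {n : ℕ} (w : finSupp (OrientedPath F n)) :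
    ∃ U : Subgroup PGL(2, F), IsOpen (U : Set PGL(2, F)) ∧
      ∀ x ∈ U, funRep PGL(2, F) (OrientedPath F n) x w.1 = w.1 := by
  refine ⟨⨅ a ∈ Function.support w.1, MulAction.stabilizer PGL(2, F) a, ?_, fun x hx => ?_⟩
  · simp only [Subgroup.coe_iInf]
    exact Set.Finite.isOpen_biInter w.2 fun a _ => OrientedPath.isOpen_stabilizer a
  · simp only [Subgroup.mem_iInf, MulAction.mem_stabilizer_iff] at hx
    funext a
    change w.1 (x⁻¹ • a) = w.1 a
    by_cases ha : w.1 a = 0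
    · by_contra h
      rw [ha] at h
      have := hx _ h
      rw [smul_inv_smul] at this
      rw [← this] at h
      exact h ha
    · rw [inv_smul_eq_iff.2 (hx a ha).symm]

/-- Stabilizers are open, so `g ↦ g⁻¹ • s` is locally constant. Thus support in `K C` means that
only finitely many fibres are involved. -/
theorem finite_inv_smul_image {C : Set PGL(2, F)} (hC : IsCompact C) (s : Vertex F) :
    ((fun g : PGL(2, F) => g⁻¹ • s) '' C).Finite := by
  let : TopologicalSpace (Vertex F) := ⊥
  have : DiscreteTopology (Vertex F) := ⟨rfl⟩
  have hcont : Continuous fun g : PGL(2, F) => g⁻¹ • s := by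
    rw [continuous_discrete_rng]
    intro t
    obtain ⟨x, hx⟩ := exists_smul_vertex_eq t s
    have : (fun g : PGL(2, F) => g⁻¹ • s) ⁻¹' {t} = (fun g => x * g⁻¹) ⁻¹'
        (MulAction.stabilizer PGL(2, F) s : Set PGL(2, F)) := by
      ext g
      simp only [Set.mem_preimage, Set.mem_singleton_iff, SetLike.mem_coe,
        MulAction.mem_stabilizer_iff, mul_smul]
      rw [← hx, smul_left_cancel_iff, hx]
    rw [this]
    exact (isOpen_stabilizer_vertex s).preimage (by fun_prop)
  exact (hC.image hcont).finite_of_discrete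

/-- The restrictions of all the translates of a class to the fibre above `s`. -/
def fibreTranslates (m : ℕ) (s : Vertex F) :
    Representation.IntertwiningMap
      ((tildeX F (2 * m - 1)).H1cRep (tildeX_isInvariant (2 * m - 1)))
      (compactInd (MulAction.stabilizer PGL(2, F) s)
        ((fibre m s).H1cRep (fibre_isInvariant m s))) where
  toFun x := ⟨fun g =>
      fibreMap m s ((tildeX F (2 * m - 1)).H1cRep (tildeX_isInvariant (2 * m - 1)) g x), by
    refine ⟨fun k g => ?_, ?_, ?_⟩
    · beta_reduce
      rw [map_mul, Module.End.mul_apply, fibreMap_stabilizer]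
    · obtain ⟨w, rfl⟩ := Submodule.Quotient.mk_surjective _ x
      obtain ⟨U, hU, h⟩ := exists_isOpen_stabilizer_finSupp w
      refine ⟨U, hU, fun x hx g => ?_⟩
      beta_reduce
      rw [map_mul, Module.End.mul_apply]
      congr 2
      refine congrArg (Submodule.Quotient.mk (p := (tildeX F (2 * m - 1)).coboundaries)) ?_
      exact Subtype.ext (h x hx)
    · obtain ⟨w, rfl⟩ := Submodule.Quotient.mk_surjective _ x
      choose t ht using fun v : Vertex F => exists_smul_vertex_eq v s
      -- The value at `g` sees only the edges above `g⁻¹ • s`. If it is nonzero, `g⁻¹ • s` is the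
      -- middle of an edge of the support, and `g` lies in the coset of the element moving that
      -- middle to `s`.
      refine ⟨(fun a => t (middle m a)) '' Function.support w.1, (w.2.image _).isCompact, ?_⟩
      intro g hg
      have : ∃ a : FibreEdge m s, w.1 (g⁻¹ • a.1) ≠ 0 := by
        by_contra! hc
        refine hg ?_
        refine (congrArg (Submodule.Quotient.mk (p := (fibre m s).coboundaries))
          (Subtype.ext (funext hc))).trans (Submodule.Quotient.mk_zero _)
      obtain ⟨a, ha⟩ := this
      refine ⟨g * (t (middle m (g⁻¹ • a.1)))⁻¹, ?_, _, ⟨_, ha, rfl⟩, by simp⟩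
      have h1 : middle m (g⁻¹ • a.1) = g⁻¹ • s := congrArg _ a.2
      rw [SetLike.mem_coe, MulAction.mem_stabilizer_iff, mul_smul, h1]
      rw [inv_smul_eq_iff.2 (ht (g⁻¹ • s)).symm, smul_inv_smul]⟩
  map_add' x y := Subtype.ext (funext fun g => by
    change fibreMap m s _ = fibreMap m s _ + fibreMap m s _
    rw [map_add, map_add])
  map_smul' c x := Subtype.ext (funext fun g => by
    change fibreMap m s _ = c • fibreMap m s _
    rw [map_smul, map_smul])
  isIntertwining' h := LinearMap.ext fun x => Subtype.ext (funext fun g => by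
    change fibreMap m s _ = fibreMap m s ((tildeX F (2 * m - 1)).H1cRep _ (g * h) x)
    rw [map_mul]
    rfl)

theorem fibreTranslates_apply {m : ℕ} {s : Vertex F} (x : (tildeX F (2 * m - 1)).H1c)
    (g : PGL(2, F)) : (fibreTranslates m s x).1 g =
      fibreMap m s ((tildeX F (2 * m - 1)).H1cRep (tildeX_isInvariant (2 * m - 1)) g x) := rfl

/-- The classes whose translates restrict to zero on the fibre are those of the cochains
`f (a⁺) - h (a⁻)`. -/
theorem fibreTranslates_mk_eq_zero_iff {m : ℕ} (hm : 1 ≤ m) (s : Vertex F)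
    (w : finSupp (OrientedPath F (2 * m - 1 + 1))) :
    fibreTranslates m s (Submodule.Quotient.mk w : (tildeX F (2 * m - 1)).H1c) = 0 ↔
      ∃ f ∈ finSupp (OrientedPath F (2 * m - 1)), ∃ h ∈ finSupp (OrientedPath F (2 * m - 1)),
        ∀ a, w.1 a = f a.tail - h a.init := by
  have hstep : ∀ g : PGL(2, F),
      (fibreTranslates m s (Submodule.Quotient.mk w : (tildeX F (2 * m - 1)).H1c)).1 g = 0 ↔
      ∃ f ∈ finSupp (FibreVertex m s), ∀ a : FibreEdge m s, w.1 (g⁻¹ • a.1) =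
        f ((fibre m s).head a) - f ((fibre m s).tail a) := fun g =>
    mk_eq_zero_iff (fibre m s) (fibreRestrict m s
      ((funRep PGL(2, F) (OrientedPath F (2 * m - 1 + 1))).subrepresentation (finSupp _)
        (finSupp_le_comap _ _) g w))
  have hzero : fibreTranslates m s (Submodule.Quotient.mk w : (tildeX F (2 * m - 1)).H1c) = 0 ↔
      ∀ g, (fibreTranslates m s (Submodule.Quotient.mk w : (tildeX F (2 * m - 1)).H1c)).1 g = 0 :=
    Subtype.ext_iff.trans funext_iff
  simp only [hzero, hstep]
  constructor
  · intro H
    choose t ht using fun v : Vertex F => exists_smul_vertex_eq v s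
    -- A primitive of `w` on the fibre above each `v`, translated from the fibre above `s`. It is
    -- taken to be zero where `w` vanishes, so that only finitely many are nonzero.
    have hv : ∀ v : Vertex F, ∃ f : OrientedPath F (2 * m - 1) → ℂ,
        ((∀ a, middle m a = v → w.1 a = 0) → f = 0) ∧
        ∀ a, middle m a = v → w.1 a = f a.tail - f a.init := by
      intro v
      by_cases h0 : ∀ a, middle m a = v → w.1 a = 0
      · exact ⟨0, fun _ => rfl, fun a ha => by simp [h0 a ha]⟩
      obtain ⟨f, -, hf⟩ := H (t v)
      classical
      refine ⟨fun p => Function.extend Subtype.val f 0 (t v • p), fun h => absurd h h0,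
        fun a ha => ?_⟩
      let b : FibreEdge m s := ⟨t v • a, by
        change middle m (t v • a) = s
        rw [middle_smul, ha, ht]⟩
      have := hf b
      rw [show b.1 = t v • a from rfl, inv_smul_smul] at this
      rw [this]
      exact congrArg₂ _ (Subtype.val_injective.extend_apply f 0 ((fibre m s).head b)).symm
        (Subtype.val_injective.extend_apply f 0 ((fibre m s).tail b)).symm
    choose f hf0 hf using hv
    have hfin : (middle m '' Function.support w.1).Finite := w.2.image _
    have hsupp : ∀ i, (fun p => f (OrientedPath.vertex p i) p) ∈
        finSupp (OrientedPath F (2 * m - 1)) := by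
      intro i
      refine (hfin.biUnion fun v _ => OrientedPath.finite_vertex_eq i v).subset fun p hp => ?_
      refine Set.mem_biUnion (x := p.vertex i) ?_ rfl
      by_contra hc
      refine hp (congrFun (hf0 _ fun a ha => ?_) p)
      by_contra hwa
      exact hc ⟨a, hwa, ha⟩
    -- The middle vertex of `a` has index `m - 1` in `a⁺` and index `m` in `a⁻`; each end point
    -- therefore selects the right primitive.
    refine ⟨_, hsupp ⟨m - 1, by omega⟩, _, hsupp ⟨m, by omega⟩, fun a => ?_⟩
    have h1 : a.tail.vertex ⟨m - 1, by omega⟩ = middle m a := by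
      rw [OrientedPath.tail_vertex]
      exact congrArg a.vertex (Fin.ext (Nat.sub_add_cancel hm))
    have h2 : a.init.vertex ⟨m, by omega⟩ = middle m a := rfl
    simp only [h1, h2]
    exact hf _ a rfl
  · rintro ⟨f, hf, h, hh, hw⟩ g
    classical
    -- In the fibre, heads carry `s` at index `m - 1` and tails at index `m`. By injectivity no path
    -- is both, so `f` on heads and `h` on tails define one function.
    refine ⟨fun v => if v.1.vertex ⟨m - 1, by omega⟩ = s then f (g⁻¹ • v.1) else h (g⁻¹ • v.1),
      ?_, fun a => ?_⟩
    · refine (Set.Finite.preimage Subtype.val_injective.injOn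
        ((finSupp_le_comap PGL(2, F) _ g hf).union (finSupp_le_comap PGL(2, F) _ g hh))).subset ?_
      intro v hv
      rw [Function.mem_support] at hv
      split_ifs at hv
      · exact Or.inl hv
      · exact Or.inr hv
    · have h1 : (OrientedPath.tail a.1).vertex ⟨m - 1, by omega⟩ = s := by
        rw [OrientedPath.tail_vertex]
        exact (congrArg a.1.vertex (Fin.ext (Nat.sub_add_cancel hm))).trans a.2
      have h2 : (OrientedPath.init a.1).vertex ⟨m - 1, by omega⟩ ≠ s := by
        intro hc
        have := a.1.injective (hc.trans a.2.symm)
        simp [Fin.ext_iff] at this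
        omega
      change w.1 (g⁻¹ • a.1) = ite (OrientedPath.vertex (OrientedPath.tail a.1) _ = s) _ _ -
        ite (OrientedPath.vertex (OrientedPath.init a.1) _ = s) _ _
      rw [if_pos h1, if_neg h2, hw]
      rfl

/-- The restriction to the fibre has an equivariant section. -/
theorem exists_fibreTranslates_section (m : ℕ) (s : Vertex F) :
    ∃ σ : Representation.IntertwiningMap
      (compactInd (MulAction.stabilizer PGL(2, F) s) ((fibre m s).H1cRep (fibre_isInvariant m s)))
      ((tildeX F (2 * m - 1)).H1cRep (tildeX_isInvariant (2 * m - 1))),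
      ∀ f, fibreTranslates m s (σ f) = f := by
  obtain ⟨j, hj, hjk⟩ := exists_equivariant_lift (H := MulAction.stabilizer PGL(2, F) s)
    (fibre m s).coboundaries ((fibre m s).coboundaries_le_comap (fibre_isInvariant m s))
  choose t ht using fun v : Vertex F => exists_smul_vertex_eq v s
  let I := compactIndSpace (MulAction.stabilizer PGL(2, F) s)
    ((fibre m s).H1cRep (fibre_isInvariant m s))
  -- The value at `a` is found by moving the middle of `a` to `s` and evaluating there the lifted
  -- cochain.
  let c : I →ₗ[ℂ] (OrientedPath F (2 * m - 1 + 1) → ℂ) :=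
    { toFun := fun f a => extendZero m s (j (f.1 (t (middle m a)))).1 (t (middle m a) • a)
      map_add' := fun f f' => funext fun a => by
        change extendZero m s (j (f.1 _ + f'.1 _)).1 _ = _
        rw [map_add, Submodule.coe_add, map_add]
        rfl
      map_smul' := fun z f => funext fun a => by
        change extendZero m s (j (z • f.1 _)).1 _ = _
        rw [map_smul, Submodule.coe_smul, map_smul]
        rfl }
  -- Any element moving the middle of `a` to `s` gives the same value: two of them differ by some
  -- `k` in the stabilizer, and `f (k x) = σ(k) f(x)` cancels against the equivariance of `j`. Both
  -- equivariance of the section and the section identity follow.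
  have hc : ∀ (f : I) (a) (g : PGL(2, F)), g • middle m a = s →
      c f a = extendZero m s (j (f.1 g)).1 (g • a) := by
    intro f a g hg
    change extendZero m s (j (f.1 (t (middle m a)))).1 (t (middle m a) • a) = _
    set x := t (middle m a) with hx
    have hxs : x • middle m a = s := ht _
    let k : MulAction.stabilizer PGL(2, F) s := ⟨g * x⁻¹, by
      rw [MulAction.mem_stabilizer_iff, mul_smul, inv_smul_eq_iff.2 hxs.symm, hg]⟩
    have hg' : g = k.1 * x := by simp [k]
    rw [hg', f.2.1 k x, mul_smul]
    have h1 := hjk k (f.1 x)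
    have h2 := extendZero_smul k (j (f.1 x)).1 (a := x • a) hxs
    refine h2.symm.trans ?_
    exact congrArg (fun w : finSupp (FibreEdge m s) => extendZero m s w.1 (k.1 • x • a)) h1.symm
  have hfin : ∀ f, c f ∈ finSupp (OrientedPath F (2 * m - 1 + 1)) := by
    intro f
    obtain ⟨C, hC, hsub⟩ := f.2.2.2
    refine ((finite_inv_smul_image hC s).biUnion fun v _ =>
      OrientedPath.finite_vertex_eq (n := 2 * m - 1 + 1) ⟨m, by omega⟩ v).subset fun a ha => ?_
    refine Set.mem_biUnion (x := middle m a) ?_ rfl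
    have hne : f.1 (t (middle m a)) ≠ 0 := by
      intro h0
      refine ha ?_
      change extendZero m s (j (f.1 (t (middle m a)))).1 (t (middle m a) • a) = 0
      rw [h0, map_zero, Submodule.coe_zero, map_zero]
      rfl
    obtain ⟨k, hk, g, hg, hkg⟩ := hsub hne
    refine ⟨g, hg, ?_⟩
    have h1 := ht (middle m a)
    rw [← hkg] at h1
    change g⁻¹ • s = middle m a
    rw [inv_smul_eq_iff]
    have h2 : (k * g) • middle m a = s := h1
    rw [mul_smul] at h2
    exact smul_left_cancel k ((show k • s = s from hk).trans h2.symm)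
  let σ₀ : I →ₗ[ℂ] (tildeX F (2 * m - 1)).H1c :=
    (Submodule.mkQ _) ∘ₗ c.codRestrict (finSupp _) hfin
  refine ⟨⟨σ₀, fun g => LinearMap.ext fun f => ?_⟩, fun f => Subtype.ext (funext fun g => ?_)⟩
  · refine congrArg (Submodule.Quotient.mk (p := (tildeX F (2 * m - 1)).coboundaries)) ?_
    refine Subtype.ext (funext fun a => ?_)
    change c (compactInd _ _ g f) a = c f (g⁻¹ • a)
    have h1 : (t (middle m a) * g) • middle m (g⁻¹ • a) = s := by
      rw [middle_smul, mul_smul, smul_inv_smul, ht]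
    rw [hc f _ _ h1, hc _ a _ (ht (middle m a)), mul_smul, smul_inv_smul]
    rfl
  · rw [fibreTranslates_apply]
    refine Eq.trans ?_ (hj (f.1 g))
    refine congrArg (Submodule.Quotient.mk (p := (fibre m s).coboundaries)) ?_
    refine Subtype.ext (funext fun a => ?_)
    change c f (g⁻¹ • a.1) = (j (f.1 g)).1 a
    have h1 : g • middle m (g⁻¹ • a.1) = s := by
      rw [middle_smul, smul_inv_smul]
      exact a.2
    rw [hc f _ g h1, smul_inv_smul, extendZero_apply]

end BruhatTits

end

theorem proposition3p11 (F : Type u) [Field F] [ValuativeRel F] [TopologicalSpace F]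
    [IsNonarchimedeanLocalField F] (hF : ringChar 𝓀[F] ≠ 2) (m : ℕ) (hm : 1 ≤ m)
    (s₀ : BruhatTits.Vertex F) :
    Nonempty (Representation.Equiv
      ((BruhatTits.tildeX F (2 * m - 1)).H1cRep (BruhatTits.tildeX_isInvariant (2 * m - 1)))
      (((BruhatTits.tildeX F (2 * m - 2)).H1cRep
          (BruhatTits.tildeX_isInvariant (2 * m - 2))).prod
        (compactInd (MulAction.stabilizer PGL(2, F) s₀)
          ((BruhatTits.fibre m s₀).H1cRep (BruhatTits.fibre_isInvariant m s₀))))) := by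
  obtain ⟨σ, hσ⟩ := BruhatTits.exists_fibreTranslates_section m s₀
  exact BruhatTits.nonempty_equiv_prod (by omega) _ (BruhatTits.fibreTranslates m s₀) σ hσ
    (BruhatTits.fibreTranslates_mk_eq_zero_iff hm s₀)
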